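/- Let $p$ be an odd prime and let $N/\mathbb{Q}$ be a totally real dihedral field of degree $2p$, that is, a totally real Galois extension of $\mathbb{Q}$ whose Galois group is isomorphic to the dihedral group of order $2p$. Let $K$ be the quadratic subfield of $N$ and let $L$ be any subfield of $N$ of degree $p$ over $\mathbb{Q}$. For a number field $F$ let $\mathcal{I}_F$ be the group of nonzero fractional ideals, $\mathcal{P}_F$ the subgroup of principal ideals, $U_F$ the group of units of the ring of integers $\mathcal{O}_F$, and $\mathrm{Cl}_F=\mathcal{I}_F/\mathcal{P}_F$. For an extension $E/F$ of degree $p$, view $\mathcal{I}_F$ as a subgroup of $\mathcal{I}_E$ by extension of ideals and put $$\mathcal{I}_{E/F}=\{\mathfrak{A}\in\mathcal{I}_E : \mathfrak{A}^p\in\mathcal{I}_F\},\qquad \mathcal{P}_{E/F}=\mathcal{I}_{E/F}\cap\mathcal{P}_E.$$ Consider the following invariants: - $U$, defined by $(U_K:N_{N/K}(U_N))=p^U$; - $A=\dim_{\mathbb{F}_p}(\mathcal{P}_{L/\mathbb{Q}}/\mathcal{P}_{\mathbb{Q}})$ (absolute principal factors); - $R=\dim_{\mathbb{F}_p}\bigl(\ker(N_{N/L})\cap((\mathcal{P}_{N/K}\mathcal{I}_K)/\mathcal{I}_K)\bigr)$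 (relative principal factors), where $N_{N/L}:\mathcal{I}_{N/K}/\mathcal{I}_K\to\mathcal{I}_{L/\mathbb{Q}}/\mathcal{I}_{\mathbb{Q}}$ is induced by the relative norm of ideals; - $C=\dim_{\mathbb{F}_p}\ker(T_{N/K})$ (capitulation kernel), where $T_{N/K}:\mathrm{Cl}_K\to\mathrm{Cl}_N$, $[\mathfrak{a}]\mapsto[\mathfrak{a}\mathcal{O}_N]$. Then these invariants are well defined (the index is a power of $p$, the three groups are finite elementary abelian $p$-groups, and $U,A,R,C$ do not depend on the choice of $L$), and $U\in\{0,1\}$ and $A+R+C=U+1$. Moreover, $N$ belongs to precisely one of the following nine differential principal factorization (DPF) types: $$\begin{array}{c|c|ccc} \text{type} & U & A & R & C\\ \hline \alpha_1 & 1 & 0 & 0 & 2\\ \alpha_2 & 1 & 0 & 1 & 1\\ \alpha_3 & 1 & 0 & 2 & 0\\ \beta_1 & 1 & 1 & 0 & 1\\ \beta_2 & 1 & 1 & 1 & 0\\ \gamma & 1 & 2 & 0 & 0\\ \delta_1 & 0 & 0 & 0 & 1\\ \delta_2 & 0 & 0 & 1 & 0\\ \varepsilon & 0 & 1 & 0 &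 0 \end{array}$$ This refines the coarse classification into the five types $\alpha,\beta,\gamma,\delta,\varepsilon$ given by $(U,A)=(1,0),(1,1),(1,2),(0,0),(0,1)$, respectively: the coarse type of $N$ is unique, and it is obtained from the DPF type by deleting the subscript. -/

import Mathlib

open NumberField Module
open scoped nonZeroDivisors

namespace DPF

noncomputable section

/-! ### Ideal groups and their maps -/

section Ideals

/-- The group `I_F` of nonzero fractional ideals of the number field `F`. -/
abbrev IdealGroup (F : Type*) [Field F] [NumberField F] : Type _ :=
  (FractionalIdeal (𝓞 F)⁰ F)ˣ

/-- The group `P_F` of nonzero principal fractional ideals of `F`. -/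
def principalIdeals (F : Type*) [Field F] [NumberField F] : Subgroup (IdealGroup F) :=
  (toPrincipalIdeal (𝓞 F) F).range

variable (F E : Type*) [Field F] [NumberField F] [Field E] [NumberField E] [Algebra F E]

/-- Extension of ideals `I_F → I_E`, `𝔞 ↦ 𝔞 𝓞_E`. -/
def extend : IdealGroup F →* IdealGroup E :=
  Units.map (FractionalIdeal.extendedHom (A := 𝓞 F) (K := F) E (𝓞 E)).toMonoidHom

/-- `I_F`, viewed as a subgroup of `I_E`. -/
def baseIdeals : Subgroup (IdealGroup E) := (extend F E).range

/-- `P_F`, viewed as a subgroup of `I_E`. -/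
def basePrincipalIdeals : Subgroup (IdealGroup E) := (principalIdeals F).map (extend F E)

/-- The group `I_{E/F}` of ambiguous ideals of an extension `E/F` of prime degree `p`:
the ideals of `E` whose `p`-th power comes from `F`. -/
def ambiguousIdeals (p : ℕ) : Subgroup (IdealGroup E) :=
  (baseIdeals F E).comap (powMonoidHom p)

/-- The group `P_{E/F} = I_{E/F} ∩ P_E` of ambiguous principal ideals of `E/F`. -/
def ambiguousPrincipalIdeals (p : ℕ) : Subgroup (IdealGroup E) :=
  ambiguousIdeals F E p ⊓ principalIdeals E

end Ideals

section Norm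

variable (F E : Type*) [Field F] [NumberField F] [Field E] [NumberField E] [Algebra F E]

/-- The relative norm of a fractional ideal of `E`: if `d I = J` with a nonzero integer `d` and
an integral ideal `J`, then the norm of `I` is `N(J) / N(d)`. -/
def relNormFun (I : FractionalIdeal (𝓞 E)⁰ E) : FractionalIdeal (𝓞 F)⁰ F :=
  (Ideal.relNorm (𝓞 F) I.num : FractionalIdeal (𝓞 F)⁰ F) /
    (Ideal.relNorm (𝓞 F) (Ideal.span {(I.den : 𝓞 E)}) : FractionalIdeal (𝓞 F)⁰ F)

lemma relNormFun_eq {I : FractionalIdeal (𝓞 E)⁰ E} {J D : Ideal (𝓞 E)} (hD : D ≠ ⊥)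
    (h : (D : FractionalIdeal (𝓞 E)⁰ E) * I = J) :
    relNormFun F E I = (Ideal.relNorm (𝓞 F) J : FractionalIdeal (𝓞 F)⁰ F) /
      (Ideal.relNorm (𝓞 F) D : FractionalIdeal (𝓞 F)⁰ F) := by
  have hden : (Ideal.span {(I.den : 𝓞 E)}) ≠ ⊥ := by
    simp
  have h1 : ((Ideal.span {(I.den : 𝓞 E)} : Ideal (𝓞 E)) : FractionalIdeal (𝓞 E)⁰ E) * I
      = (I.num : FractionalIdeal (𝓞 E)⁰ E) := by
    rw [FractionalIdeal.coeIdeal_span_singleton]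
    exact FractionalIdeal.den_mul_self_eq_num' _ _ I
  have key : I.num * D = J * Ideal.span {(I.den : 𝓞 E)} := by
    apply FractionalIdeal.coeIdeal_injective (K := E)
    change ((I.num * D : Ideal (𝓞 E)) : FractionalIdeal (𝓞 E)⁰ E) =
      ((J * Ideal.span {(I.den : 𝓞 E)} : Ideal (𝓞 E)) : FractionalIdeal (𝓞 E)⁰ E)
    rw [FractionalIdeal.coeIdeal_mul, FractionalIdeal.coeIdeal_mul, ← h1, ← h]
    ring
  have key2 := congrArg (fun X : Ideal (𝓞 E) =>
    (Ideal.relNorm (𝓞 F) X : FractionalIdeal (𝓞 F)⁰ F)) key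
  simp only [map_mul, FractionalIdeal.coeIdeal_mul] at key2
  unfold relNormFun
  rw [div_eq_div_iff]
  · exact key2
  · rw [FractionalIdeal.coeIdeal_ne_zero, Ne, Ideal.relNorm_eq_bot_iff]
    exact hden
  · rw [FractionalIdeal.coeIdeal_ne_zero, Ne, Ideal.relNorm_eq_bot_iff]
    exact hD

/-- The relative norm `N_{E/F}` on fractional ideals. -/
def relNormHom : FractionalIdeal (𝓞 E)⁰ E →* FractionalIdeal (𝓞 F)⁰ F where
  toFun := relNormFun F E
  map_one' := by
    rw [relNormFun_eq F E (I := 1) (J := ⊤) (D := ⊤) (by simp) (by simp)]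
    simp
  map_mul' I J := by
    rw [relNormFun_eq F E (I := I * J) (J := I.num * J.num)
      (D := Ideal.span {(I.den : 𝓞 E)} * Ideal.span {(J.den : 𝓞 E)})]
    · simp only [map_mul, FractionalIdeal.coeIdeal_mul, relNormFun]
      rw [div_mul_div_comm]
    · simp
    · rw [FractionalIdeal.coeIdeal_mul, FractionalIdeal.coeIdeal_mul,
        ← FractionalIdeal.den_mul_self_eq_num' _ _ I,
        ← FractionalIdeal.den_mul_self_eq_num' _ _ J,
        FractionalIdeal.coeIdeal_span_singleton, FractionalIdeal.coeIdeal_span_singleton]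
      ring

/-- The relative norm homomorphism `N_{E/F} : I_E → I_F`. -/
def idealNorm : IdealGroup E →* IdealGroup F := Units.map (relNormHom F E)

end Norm

/-! ### The invariants `U`, `A`, `R`, `C` -/

/-- `G` is an `𝔽_p`-vector space of dimension `d`. -/
def HasFpDim (p : ℕ) (G : Type*) [CommGroup G] (d : ℕ) : Prop :=
  Nonempty (Additive G ≃+ (Fin d → ZMod p))

/-- The quotient `S / (S ∩ T)` of two subgroups of an abelian group, which is `S / T` if
`T ≤ S`. -/
abbrev SubQuotient {G : Type*} [CommGroup G] (S T : Subgroup G) : Type _ :=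
  S ⧸ T.subgroupOf S

section Invariants

variable (p : ℕ) (N : Type*) [Field N] [NumberField N] (K L : IntermediateField ℚ N)

/-- The group `N_{N/K}(U_N)` of norms of units, as a subgroup of `U_K`. -/
def normUnits : Subgroup (𝓞 K)ˣ :=
  (Units.map (RingOfIntegers.norm K : 𝓞 N →* 𝓞 K)).range

/-- The absolute principal factors `P_{L/ℚ} / P_ℚ` of `L/ℚ`. -/
abbrev AbsolutePrincipalFactors : Type _ :=
  SubQuotient (ambiguousPrincipalIdeals ℚ L p) (basePrincipalIdeals ℚ L)

/-- The ambiguous ideals of `N/K` whose class modulo `I_K` is in the kernel of the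
homomorphism `I_{N/K} / I_K → I_{L/ℚ} / I_ℚ` that is induced by the norm `N_{N/L}`. -/
def normKernel : Subgroup (IdealGroup N) :=
  ambiguousIdeals K N p ⊓ (baseIdeals ℚ L).comap (idealNorm L N)

/-- The relative principal factors `ker(N_{N/L}) ∩ ((P_{N/K} I_K) / I_K)` of `N/K`. -/
abbrev RelativePrincipalFactors : Type _ :=
  SubQuotient (normKernel p N K L ⊓ (ambiguousPrincipalIdeals K N p ⊔ baseIdeals K N))
    (baseIdeals K N)

/-- The capitulation kernel: the kernel of the extension of ideal classes `Cl_K → Cl_N`. -/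
abbrev CapitulationKernel : Type _ :=
  (ClassGroup.extendedHom (𝓞 K) (𝓞 N)).ker

end Invariants

/-- The invariants `(U, A, R, C)`. -/
@[ext] structure Invariants where
  U : ℕ
  A : ℕ
  R : ℕ
  C : ℕ

/-- `v = (U, A, R, C)` are the invariants of the dihedral field `N` of degree `2p`: for the
quadratic subfield `K` and each subfield `L` of degree `p` one has `(U_K : N_{N/K}(U_N)) = p ^ U`,
and `A`, `R`, `C` are the `𝔽_p`-dimensions of the absolute principal factors, the relative
principal factors, and the capitulation kernel. -/
def HasInvariants (p : ℕ) (N : Type*) [Field N] [NumberField N] (v : Invariants) : Prop :=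
  ∀ K L : IntermediateField ℚ N, finrank ℚ K = 2 → finrank ℚ L = p →
    (normUnits N K).index = p ^ v.U ∧
    HasFpDim p (AbsolutePrincipalFactors p N L) v.A ∧
    HasFpDim p (RelativePrincipalFactors p N K L) v.R ∧
    HasFpDim p (CapitulationKernel N K) v.C

/-! ### Types -/

/-- The nine differential principal factorization types of totally real dihedral fields. -/
inductive FineType
  | alpha1 | alpha2 | alpha3 | beta1 | beta2 | gamma | delta1 | delta2 | epsilon

/-- The table of invariants `(U, A, R, C)` of the nine types. -/
def FineType.invariants : FineType → Invariants
  | alpha1 => ⟨1, 0, 0, 2⟩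
  | alpha2 => ⟨1, 0, 1, 1⟩
  | alpha3 => ⟨1, 0, 2, 0⟩
  | beta1 => ⟨1, 1, 0, 1⟩
  | beta2 => ⟨1, 1, 1, 0⟩
  | gamma => ⟨1, 2, 0, 0⟩
  | delta1 => ⟨0, 0, 0, 1⟩
  | delta2 => ⟨0, 0, 1, 0⟩
  | epsilon => ⟨0, 1, 0, 0⟩

/-- The dihedral field `N` of degree `2p` belongs to the type `τ`. -/
def HasFineType (p : ℕ) (N : Type*) [Field N] [NumberField N] (τ : FineType) : Prop :=
  HasInvariants p N τ.invariants

/-- The five coarse types (Moser) of totally real dihedral fields. -/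
inductive CoarseType
  | alpha | beta | gamma | delta | epsilon

/-- The invariants `(U, A)` of the five coarse types. -/
def CoarseType.invariants : CoarseType → ℕ × ℕ
  | alpha => (1, 0)
  | beta => (1, 1)
  | gamma => (1, 2)
  | delta => (0, 0)
  | epsilon => (0, 1)

/-- The dihedral field `N` of degree `2p` belongs to the coarse type `μ`. -/
def HasCoarseType (p : ℕ) (N : Type*) [Field N] [NumberField N] (μ : CoarseType) : Prop :=
  ∀ K L : IntermediateField ℚ N, finrank ℚ K = 2 → finrank ℚ L = p →
    (normUnits N K).index = p ^ μ.invariants.1 ∧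
    HasFpDim p (AbsolutePrincipalFactors p N L) μ.invariants.2

/-- The coarse type that contains a given fine type. -/
def FineType.coarse : FineType → CoarseType
  | alpha1 | alpha2 | alpha3 => .alpha
  | beta1 | beta2 => .beta
  | gamma => .gamma
  | delta1 | delta2 => .delta
  | epsilon => .epsilon

end

end DPF

/-! Let σ generate Gal(N/K), which is cyclic of order p. Everything rests on the order of
P_{N/K}/P_K. A principal ideal (x) lies in P_{N/K} exactly when σx/x is a unit, and by Hilbert 90
the map x ↦ σx/x identifies P_{N/K}/P_K with the units of relative norm 1 modulo the units σu/u. The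
Herbrand quotient of the unit group, computed from Dirichlet ranks, gives this quotient the order p
· (U_K : N_{N/K}(U_N)); see `herbrand_quotient` and `relIndex_ambiguousPrincipalIdeals`. As U_K has
rank 1, the norm index divides p, so U is 0 or 1 and the order is p^(U+1).

The same group is then filtered. The ideals in it that come from K contribute the capitulation
kernel (`relIndex_ambiguousPrincipalIdeals_eq_mul`). On the rest, P_{N/K} I_K / I_K, the norm
N_{N/L} has the relative principal factors as kernel and the absolute ones as image, because [N:L] =
2 is prime to p (`relIndex_ambiguousPrincipalIdeals_sup`). Comparing orders gives A + R + C = U + 1,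
and the nine types are all solutions of this equation.

The choice of L is immaterial: the subfields of degree p are conjugate under Gal(N/K), which fixes
every ideal of P_{N/K}, so all of them have the same absolute principal factors inside I_N. The
product formula then settles R. -/

namespace DPF

/-! ### Herbrand quotient of a module over a cyclic group of order p -/

section Herbrand

-- Binomial expansion of `((X + 1) ^ p - 1) / X`: the coefficients below the leading one are
-- divisible by p, and the constant term is p itself. For X = σ - 1 the left side is the norm
-- element.
open Polynomial in
theorem exists_geom_sum_X_add_one_eq {p : ℕ} (hp : p.Prime) :
    ∃ k : ℤ[X], ∑ i ∈ Finset.range p, (X + 1 : ℤ[X]) ^ i =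
      X ^ (p - 1) + (p : ℤ[X]) * (1 + X * k) := by
  obtain ⟨r, hr⟩ := exists_add_pow_prime_eq hp (X : ℤ[X]) 1
  have h1 : (∑ i ∈ Finset.range p, (X + 1 : ℤ[X]) ^ i) = X ^ (p - 1) + (p : ℤ[X]) * r := by
    have h := geom_sum_mul (X + 1 : ℤ[X]) p
    rw [add_sub_cancel_right, hr] at h
    have hX : (X : ℤ[X]) ^ p = X ^ (p - 1) * X := by
      rw [← pow_succ, Nat.sub_add_cancel hp.one_le]
    apply mul_right_cancel₀ (X_ne_zero (R := ℤ))
    rw [h, hX]; ring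
  have h2 : r.eval 0 = 1 := by
    have h := congrArg (Polynomial.eval 0) h1
    have hp1 : p - 1 ≠ 0 := by have := hp.two_le; omega
    simp [Polynomial.eval_finsetSum, hp1] at h
    simpa [hp.ne_zero] using h
  obtain ⟨k, hk⟩ : X ∣ r - 1 := by
    rw [X_dvd_iff, coeff_zero_eq_eval_zero]; simp [h2]
  exact ⟨k, by rw [h1, ← hk]; ring⟩

-- Modulo the norm element, p is a multiple of `X ^ (p - 1)`, just as for p and (ζ - 1)^(p - 1) in
-- ℤ[ζ]. The factor `1 + X * k` of the previous expansion is inverted modulo `X ^ (p - 1)` by a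
-- geometric series.
open Polynomial in
theorem exists_prime_eq_geom_sum_combination {p : ℕ} (hp : p.Prime) :
    ∃ a b : ℤ[X], (p : ℤ[X]) =
      (∑ i ∈ Finset.range p, (X + 1 : ℤ[X]) ^ i) * a + X ^ (p - 1) * b := by
  obtain ⟨k, hk⟩ := exists_geom_sum_X_add_one_eq hp
  rw [hk]
  have h := mul_neg_geom_sum (-(X * k)) (p - 1)
  refine ⟨∑ i ∈ Finset.range (p - 1), (-(X * k)) ^ i,
    (p : ℤ[X]) * (-k) ^ (p - 1) - ∑ i ∈ Finset.range (p - 1), (-(X * k)) ^ i, ?_⟩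
  have h3 : (-(X * k)) ^ (p - 1) = X ^ (p - 1) * (-k) ^ (p - 1) := by
    rw [← mul_pow]; ring
  rw [h3] at h
  linear_combination -(p : ℤ[X]) * h

variable {V : Type*} [AddCommGroup V]

theorem index_range_pow_of_injective (y : AddMonoid.End V) (hy : Function.Injective y) (n : ℕ) :
    (AddMonoidHom.range (y ^ n : AddMonoid.End V)).index = (AddMonoidHom.range y).index ^ n := by
  induction n with
  | zero =>
    rw [pow_zero, pow_zero, AddSubgroup.index_eq_one, eq_top_iff]
    exact fun x _ => ⟨x, rfl⟩
  | succ n ih =>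
    have h : AddMonoidHom.range (y ^ (n + 1) : AddMonoid.End V) =
        (AddMonoidHom.range (y ^ n : AddMonoid.End V)).map y := by
      rw [pow_succ']
      exact (AddMonoidHom.map_range y (y ^ n : AddMonoid.End V)).symm
    rw [h, AddSubgroup.index_map_of_injective _ hy, ih, pow_succ]

-- A module killed by the norm element is a ℤ[ζ]-module on which `y` acts as ζ - 1, so `y ^ (p - 1)`
-- and p have the same image. Absence of p-torsion makes `y` injective, and then the index of the
-- image of a power is the power of the index.
open Polynomial in
theorem index_range_pow_pred {p : ℕ} (hp : p.Prime) (y : AddMonoid.End V)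
    (hy : ∑ i ∈ Finset.range p, (y + 1) ^ i = 0) (hinj : ∀ v : V, p • v = 0 → v = 0) :
    (AddMonoidHom.range y).index ^ (p - 1) = (nsmulAddMonoidHom (α := V) p).range.index := by
  have hgeom : aeval y (∑ i ∈ Finset.range p, (X + 1 : ℤ[X]) ^ i) = 0 := by
    simpa [map_sum] using hy
  obtain ⟨k, hk⟩ := exists_geom_sum_X_add_one_eq hp
  obtain ⟨a, b, hab⟩ := exists_prime_eq_geom_sum_combination hp
  have e1 : y ^ (p - 1) = (p : AddMonoid.End V) * aeval y (-(1 + X * k)) := by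
    have := congrArg (aeval y) hk
    rw [hgeom] at this
    simp only [map_add, map_mul, map_pow, aeval_X, map_natCast, map_neg] at this ⊢
    rw [mul_neg, eq_neg_iff_add_eq_zero]
    exact this.symm
  have e2 : (p : AddMonoid.End V) = y ^ (p - 1) * aeval y b := by
    have := congrArg (aeval y) hab
    rw [map_add, map_mul, hgeom] at this
    simpa using this
  have hcast : ∀ v : V, (p : AddMonoid.End V) v = p • v := fun v => by simp
  have hyinj : Function.Injective y := by
    rw [injective_iff_map_eq_zero]
    intro v hv
    apply hinj
    rw [← hcast, e2]
    have hc : y ^ (p - 1) * aeval y b = aeval y b * y ^ (p - 1) := by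
      have : (aeval y) (X ^ (p - 1) * b) = (aeval y) (b * X ^ (p - 1)) := by rw [mul_comm]
      simpa using this
    rw [hc]
    have hp1 : p - 1 = (p - 2) + 1 := by have := hp.two_le; omega
    rw [hp1, pow_succ]
    change (aeval y b) ((y ^ (p - 2) : AddMonoid.End V) (y v)) = 0
    rw [hv, map_zero, map_zero]
  rw [← index_range_pow_of_injective y hyinj]
  congr 1
  apply le_antisymm
  · rintro _ ⟨v, rfl⟩
    exact ⟨aeval y (-(1 + X * k)) v, by rw [e1]; exact (hcast _).symm⟩
  · rintro _ ⟨v, rfl⟩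
    refine ⟨aeval y b v, ?_⟩
    change (y ^ (p - 1) * aeval y b : AddMonoid.End V) v = p • v
    rw [← e2, hcast]

/-- The index is split at `A ⊔ C`; the modular law reduces each of the two steps to one summand. -/
theorem relIndex_sup_sup_of_disjoint {A W B C : AddSubgroup V} (hAW : A ⊓ W = ⊥) (hB : B ≤ A)
    (hC : C ≤ W) : (B ⊔ C).relIndex (A ⊔ W) = B.relIndex A * C.relIndex W := by
  have h1 : (B ⊔ C) ⊓ A = B := by
    rw [sup_inf_assoc_of_le _ hB, le_bot_iff.mp ((inf_le_inf_right A hC).trans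
      (by rw [inf_comm, hAW])), sup_bot_eq]
  have h2 : (A ⊔ C) ⊓ W = C := by
    rw [sup_comm, sup_inf_assoc_of_le _ hC, hAW, sup_bot_eq]
  rw [← AddSubgroup.relIndex_mul_relIndex (B ⊔ C) (A ⊔ C) (A ⊔ W) (sup_le_sup_right hB C)
    (sup_le_sup_left hC A)]
  congr 1
  · rw [← AddSubgroup.inf_relIndex_right (B ⊔ C) A |>.trans
      (show (B ⊔ C).relIndex A = (B ⊔ C).relIndex (A ⊔ C) from ?_), h1]
    rw [← AddSubgroup.relIndex_sup_right A (B ⊔ C)]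
    congr 1
    rw [← sup_assoc, sup_eq_left.mpr hB]
  · rw [← AddSubgroup.inf_relIndex_right (A ⊔ C) W |>.trans
      (show (A ⊔ C).relIndex W = (A ⊔ C).relIndex (A ⊔ W) from ?_), h2]
    rw [← AddSubgroup.relIndex_sup_right W (A ⊔ C)]
    congr 1
    rw [← sup_assoc, sup_comm W A, sup_assoc, sup_eq_left.mpr hC]

theorem index_ker_sup_eq (f : V →+ V) (B : AddSubgroup V) :
    (B.map f).relIndex f.range = (B ⊔ f.ker).index := by
  rw [AddMonoidHom.range_eq_map, AddSubgroup.relIndex_map_map, top_sup_eq,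
    AddSubgroup.relIndex_top_right]

/-- The Herbrand quotient of a `ℤ[C_p]`-module without `p`-torsion, computed from the ranks. -/
theorem herbrand_quotient {p : ℕ} (hp : p.Prime) (y : AddMonoid.End V) (hy : (y + 1) ^ p = 1)
    (hinj : ∀ v : V, p • v = 0 → v = 0) (g : AddMonoid.End V)
    (hg : g = ∑ i ∈ Finset.range p, (y + 1) ^ i) {r t : ℕ}
    (hA : ((AddMonoidHom.ker y).map (nsmulAddMonoidHom p)).relIndex (AddMonoidHom.ker y) = p ^ r)
    (hV : (nsmulAddMonoidHom (α := V) p).range.index = p ^ (r + (p - 1) * t)) :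
    (AddMonoidHom.range g).relIndex (AddMonoidHom.ker y) ∣ p ^ r ∧
    (AddMonoidHom.range y).relIndex (AddMonoidHom.ker g) * p ^ r =
      p ^ t * (AddMonoidHom.range g).relIndex (AddMonoidHom.ker y) := by
  have hgy : g * y = 0 := by
    have := geom_sum_mul (y + 1) p
    rwa [add_sub_cancel_right, hy, sub_self, ← hg] at this
  have hyg : y * g = 0 := by
    have := mul_geom_sum (y + 1) p
    rwa [add_sub_cancel_right, hy, sub_self, ← hg] at this
  have hgy' : ∀ v, g (y v) = 0 := fun v => DFunLike.congr_fun hgy v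
  have hyg' : ∀ v, y (g v) = 0 := fun v => DFunLike.congr_fun hyg v
  -- The automorphism `y + 1` is trivial on the kernel of `y`, so its norm is multiplication by p
  -- there.
  have hgA : ∀ v, y v = 0 → g v = p • v := by
    intro v hv
    have h1 : (y + 1) v = v := by
      change y v + v = v
      rw [hv, zero_add]
    have h2 : ∀ i : ℕ, ((y + 1) ^ i) v = v := by
      intro i
      induction i with
      | zero => rfl
      | succ i ih =>
        rw [pow_succ]
        change ((y + 1) ^ i) ((y + 1) v) = v
        rw [h1, ih]
    have h3 : g v = ∑ i ∈ Finset.range p, ((y + 1) ^ i) v := by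
      rw [hg]; exact AddMonoidHom.finsetSum_apply _ _ _
    rw [h3]
    simp [h2]
  set A : AddSubgroup V := AddMonoidHom.ker y
  set W : AddSubgroup V := AddMonoidHom.ker g
  have hAW : A ⊓ W = ⊥ := by
    rw [eq_bot_iff]
    rintro v ⟨h1, h2⟩
    exact hinj v (by rw [← hgA v h1]; exact h2)
  have hgrange : AddMonoidHom.range g ≤ A := by rintro _ ⟨v, rfl⟩; exact hyg' v
  have hyrange : AddMonoidHom.range y ≤ W := by rintro _ ⟨v, rfl⟩; exact hgy' v
  have hmapg : A.map g = A.map (nsmulAddMonoidHom p) := by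
    ext v
    constructor
    · rintro ⟨w, hw, rfl⟩; exact ⟨w, hw, (hgA w hw).symm⟩
    · rintro ⟨w, hw, rfl⟩; exact ⟨w, hw, hgA w hw⟩
  have hpinj : Function.Injective (nsmulAddMonoidHom (α := V) p) := by
    rw [injective_iff_map_eq_zero]; exact hinj
  -- the index of `A ⊕ W`, computed with `g` and with `y`
  have i1 : (A ⊔ W).index * (AddMonoidHom.range g).relIndex A = p ^ r := by
    rw [← hA, ← hmapg, ← index_ker_sup_eq g A]
    exact AddSubgroup.relIndex_mul_relIndex _ _ _ (by
      rintro _ ⟨v, _, rfl⟩; exact ⟨v, rfl⟩) hgrange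
  have i2 : (A ⊔ W).index * (AddMonoidHom.range y).relIndex W = (W.map y).relIndex W := by
    rw [sup_comm, ← index_ker_sup_eq y W]
    exact AddSubgroup.relIndex_mul_relIndex _ _ _ (by
      rintro _ ⟨v, _, rfl⟩; exact ⟨v, rfl⟩) hyrange
  have hm : (A ⊔ W).index ≠ 0 := by
    intro h
    rw [h, zero_mul] at i1
    exact pow_ne_zero r hp.ne_zero i1.symm
  -- Multiplication by p is injective, so a subgroup of finite index has the same index modulo p as
  -- V itself. Dividing out the contribution of `A` leaves that of `W`.
  have i3 : ((A ⊔ W).map (nsmulAddMonoidHom p)).relIndex (A ⊔ W) = p ^ (r + (p - 1) * t) := by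
    have h1 := AddSubgroup.index_map_of_injective (A ⊔ W) hpinj
    have h2 := AddSubgroup.relIndex_mul_index (H := (A ⊔ W).map (nsmulAddMonoidHom p)) (K := A ⊔ W)
      (by rintro _ ⟨v, hv, rfl⟩; exact AddSubgroup.nsmul_mem _ hv p)
    rw [← hV]
    apply Nat.eq_of_mul_eq_mul_left (Nat.pos_of_ne_zero hm)
    rw [← h1, ← h2, mul_comm]
  have i4 : (W.map (nsmulAddMonoidHom p)).relIndex W = p ^ ((p - 1) * t) := by
    rw [AddSubgroup.map_sup, relIndex_sup_sup_of_disjoint hAW, hA, pow_add] at i3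
    · exact Nat.eq_of_mul_eq_mul_left (pow_pos hp.pos r) i3
    · rintro _ ⟨v, hv, rfl⟩; exact AddSubgroup.nsmul_mem _ hv p
    · rintro _ ⟨v, hv, rfl⟩; exact AddSubgroup.nsmul_mem _ hv p
  -- restriction of `y` to `W`
  let yW : AddMonoid.End W := (AddMonoidHom.comp (y : V →+ V) W.subtype).codRestrict W
    (fun w => hgy' w)
  have hyW : ∀ w : W, ((yW w : W) : V) = y w := fun w => rfl
  have hyW1 : ∀ (i : ℕ) (w : W), ((((yW + 1) ^ i : AddMonoid.End W) w : W) : V) =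
      ((y + 1) ^ i : AddMonoid.End V) w := by
    intro i
    induction i with
    | zero => intro w; rfl
    | succ i ih =>
      intro w
      rw [pow_succ, pow_succ]
      exact ih ((yW + 1) w)
  have hsum : ∑ i ∈ Finset.range p, (yW + 1) ^ i = 0 := by
    ext w
    have h3 : (∑ i ∈ Finset.range p, (yW + 1) ^ i) w = ∑ i ∈ Finset.range p, ((yW + 1) ^ i) w :=
      AddMonoidHom.finsetSum_apply _ _ _
    have h4 : g w = ∑ i ∈ Finset.range p, ((y + 1) ^ i) (w : V) := by
      rw [hg]; exact AddMonoidHom.finsetSum_apply _ _ _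
    rw [h3, AddSubgroup.val_finsetSum]
    simp_rw [hyW1]
    rw [← h4]
    exact w.2
  have key := index_range_pow_pred hp yW hsum (fun w hw => Subtype.ext (hinj w (by
    simpa using congrArg Subtype.val hw)))
  have j1 : (AddMonoidHom.range yW).index = (W.map y).relIndex W := by
    rw [AddSubgroup.relIndex]
    congr 1
    ext w
    constructor
    · rintro ⟨v, rfl⟩; exact ⟨v, v.2, rfl⟩
    · rintro ⟨v, hv, h⟩; exact ⟨⟨v, hv⟩, Subtype.ext h⟩
  have j2 : (nsmulAddMonoidHom (α := W) p).range.index =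
      (W.map (nsmulAddMonoidHom p)).relIndex W := by
    rw [AddSubgroup.relIndex]
    congr 1
    ext w
    constructor
    · rintro ⟨v, rfl⟩; exact ⟨v, v.2, rfl⟩
    · rintro ⟨v, hv, h⟩; exact ⟨⟨v, hv⟩, Subtype.ext h⟩
  rw [j1, j2, i4, mul_comm, pow_mul] at key
  have hp1 : p - 1 ≠ 0 := by have := hp.two_le; omega
  -- This is [W : yW] = p^t. The index of `A ⊔ W` is unknown, but it occurs in both `i1` and `i2`
  -- and is eliminated between them.
  have i5 := Nat.pow_left_injective hp1 key
  refine ⟨Dvd.intro_left _ i1, ?_⟩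
  rw [← i5, ← i2, ← i1]
  ring

/-- Multiplicative form of `herbrand_quotient`. -/
theorem herbrand_quotient_mul {V : Type*} [CommGroup V] {p : ℕ} (hp : p.Prime) (s : V →* V)
    (hs : ∀ v, s^[p] v = v) (hinj : ∀ v : V, v ^ p = 1 → v = 1) (δ ν : V →* V)
    (hδ : ∀ v, δ v = s v / v) (hν : ∀ v, ν v = ∏ i ∈ Finset.range p, s^[i] v) {r t : ℕ}
    (hA : (δ.ker.map (powMonoidHom p)).relIndex δ.ker = p ^ r)
    (hV : (powMonoidHom (α := V) p).range.index = p ^ (r + (p - 1) * t)) :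
    ν.range.relIndex δ.ker ∣ p ^ r ∧
      δ.range.relIndex ν.ker * p ^ r = p ^ t * ν.range.relIndex δ.ker := by
  let y : AddMonoid.End (Additive V) := MonoidHom.toAdditive δ
  let g : AddMonoid.End (Additive V) := MonoidHom.toAdditive ν
  have hy1 : ∀ (i : ℕ) (v : Additive V),
      ((y + 1) ^ i : AddMonoid.End (Additive V)) v = Additive.ofMul (s^[i] v.toMul) := by
    intro i
    induction i with
    | zero => intro v; rfl
    | succ i ih =>
      intro v
      have h : (y + 1) v = Additive.ofMul (s v.toMul) := by
        change Additive.ofMul (δ v.toMul * v.toMul) = _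
        rw [hδ, div_mul_cancel]
      rw [pow_succ, Function.iterate_succ_apply]
      exact (congrArg _ h).trans (ih _)
  have hy : (y + 1) ^ p = 1 := by
    ext v
    rw [hy1, hs]; rfl
  have hg : g = ∑ i ∈ Finset.range p, (y + 1) ^ i := by
    ext v
    have h3 : (∑ i ∈ Finset.range p, (y + 1) ^ i) v = ∑ i ∈ Finset.range p, ((y + 1) ^ i) v :=
      AddMonoidHom.finsetSum_apply _ _ _
    rw [h3]
    simp_rw [hy1]
    change Additive.ofMul (ν v.toMul) = _
    rw [hν, ofMul_prod]; rfl
  exact herbrand_quotient (V := Additive V) hp y hy hinj g hg hA hV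

end Herbrand

/-! ### Units of totally real fields -/

section Units

variable (F : Type*) [Field F]

theorem exists_realEmbedding [NumberField F] [IsTotallyReal F] : Nonempty (F →+* ℝ) :=
  ⟨ComplexEmbedding.IsReal.embedding
    (IsTotallyReal.complexEmbedding_isReal (Classical.arbitrary (F →+* ℂ)))⟩

variable {F} in
theorem eq_one_of_pow_eq_one_of_odd [NumberField F] [IsTotallyReal F] {n : ℕ} (hn : Odd n) {x : F}
    (hx : x ^ n = 1) : x = 1 := by
  obtain ⟨φ⟩ := exists_realEmbedding F
  apply φ.injective
  apply hn.strictMono_pow.injective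
  simp only
  rw [← map_pow, hx, map_one, one_pow]

-- A real embedding sends a root of unity to ±1, so its square is 1.
variable {F} in
theorem units_pow_eq_self_of_mem_torsion [NumberField F] [IsTotallyReal F] {n : ℕ}
    (hn : Odd n) {x : (𝓞 F)ˣ}
    (hx : x ∈ Units.torsion F) : x ^ n = x := by
  obtain ⟨φ⟩ := exists_realEmbedding F
  obtain ⟨m, hm, hxm⟩ := isOfFinOrder_iff_pow_eq_one.mp ((CommGroup.mem_torsion x).1 hx)
  have h1 : φ (x : F) ^ m = 1 := by
    rw [← map_pow, ← Units.coe_pow, hxm]; simp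
  have h2 : x ^ 2 = 1 := by
    apply Units.coe_injective F
    apply φ.injective
    change φ ((x ^ 2 : (𝓞 F)ˣ) : F) = φ ((1 : (𝓞 F)ˣ) : F)
    rw [Units.coe_pow, map_pow, ← sq_abs]
    have : |φ (x : F)| = 1 := by
      rw [← pow_eq_one_iff_of_nonneg (abs_nonneg _) hm.ne', ← abs_pow, h1, abs_one]
    rw [this]; simp
  obtain ⟨k, rfl⟩ := hn
  rw [pow_succ, pow_mul, h2, one_pow, one_mul]

theorem units_rank_add_one [NumberField F] [IsTotallyReal F] : Units.rank F + 1 = finrank ℚ F := by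
  classical
  rw [IsTotallyReal.finrank, Units.rank, InfinitePlace.card_eq_nrRealPlaces_add_nrComplexPlaces,
    IsTotallyReal.nrComplexPlaces_eq_zero, add_zero, Nat.sub_add_cancel]
  rw [← IsTotallyReal.finrank]
  exact finrank_pos

/-- Torsion units are n-th powers for odd n, so the index can be computed in the free quotient of
rank `Units.rank F`. -/
theorem index_range_pow_units [NumberField F] [IsTotallyReal F] {n : ℕ} (hn : Odd n) :
    (powMonoidHom (α := (𝓞 F)ˣ) n).range.index = n ^ Units.rank F := by
  let π := QuotientGroup.mk' (Units.torsion F)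
  have hπ : Function.Surjective π := QuotientGroup.mk'_surjective _
  have hker : π.ker ≤ (powMonoidHom (α := (𝓞 F)ˣ) n).range := by
    rw [QuotientGroup.ker_mk']
    exact fun x hx => ⟨x, units_pow_eq_self_of_mem_torsion hn hx⟩
  have h := Subgroup.index_map_eq _ hπ hker
  have hr : (powMonoidHom (α := (𝓞 F)ˣ) n).range.map π =
      (powMonoidHom (α := (𝓞 F)ˣ ⧸ Units.torsion F) n).range := by
    ext x
    constructor
    · rintro ⟨_, ⟨v, rfl⟩, rfl⟩
      exact ⟨π v, (map_pow π v n).symm⟩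
    · rintro ⟨v, rfl⟩
      obtain ⟨v, rfl⟩ := hπ v
      exact ⟨_, ⟨v, rfl⟩, map_pow π v n⟩
  rw [← h, hr]
  have := AddSubgroup.index_range_nsmul (M := Additive ((𝓞 F)ˣ ⧸ Units.torsion F)) n
  rw [Units.finrank_modTorsion] at this
  exact this

/-- The units of the ring of integers, as a homomorphism to the multiplicative group. -/
def unitsToField : (𝓞 F)ˣ →* Fˣ := _root_.Units.map (algebraMap (𝓞 F) F).toMonoidHom

variable {F}

@[simp]
theorem coe_unitsToField (u : (𝓞 F)ˣ) : (unitsToField F u : F) = (u : F) := rfl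

theorem unitsToField_injective : Function.Injective (unitsToField F) := fun _ _ h =>
  Units.coe_injective F (congrArg (fun x : Fˣ => (x : F)) h)

theorem mem_range_unitsToField_iff {x : Fˣ} :
    x ∈ (unitsToField F).range ↔ IsIntegral ℤ (x : F) ∧ IsIntegral ℤ ((x⁻¹ : Fˣ) : F) := by
  constructor
  · rintro ⟨u, rfl⟩
    refine ⟨RingOfIntegers.isIntegral_coe _, ?_⟩
    rw [← map_inv]
    exact RingOfIntegers.isIntegral_coe _
  · rintro ⟨h1, h2⟩
    refine ⟨⟨⟨x, h1⟩, ⟨(x⁻¹ : Fˣ), h2⟩, ?_, ?_⟩, ?_⟩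
    · apply RingOfIntegers.ext; exact x.mul_inv
    · apply RingOfIntegers.ext; exact x.inv_mul
    · ext; rfl

theorem mem_range_unitsToField_of_pow {x : Fˣ} {n : ℕ} (hn : n ≠ 0)
    (h : x ^ n ∈ (unitsToField F).range) : x ∈ (unitsToField F).range := by
  rw [mem_range_unitsToField_iff] at h ⊢
  refine ⟨IsIntegral.of_pow (Nat.pos_of_ne_zero hn) (by simpa using h.1),
    IsIntegral.of_pow (Nat.pos_of_ne_zero hn) (by simpa using h.2)⟩

theorem ker_toPrincipalIdeal [NumberField F] :
    (toPrincipalIdeal (𝓞 F) F).ker = (unitsToField F).range := by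
  have key : ∀ x : Fˣ, toPrincipalIdeal (𝓞 F) F x = 1 → IsIntegral ℤ (x : F) := by
    intro x hx
    rw [toPrincipalIdeal_eq_iff, _root_.Units.val_one] at hx
    have : (x : F) ∈ (1 : FractionalIdeal (𝓞 F)⁰ F) := by
      rw [← hx]; exact FractionalIdeal.mem_spanSingleton_self _ _
    obtain ⟨y, hy⟩ := (FractionalIdeal.mem_one_iff _).mp this
    rw [← hy]; exact RingOfIntegers.isIntegral_coe _
  ext x
  constructor
  · intro hx
    rw [mem_range_unitsToField_iff]
    refine ⟨key x hx, key x⁻¹ ?_⟩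
    rw [map_inv, MonoidHom.mem_ker.mp hx, inv_one]
  · rintro ⟨u, rfl⟩
    rw [MonoidHom.mem_ker, toPrincipalIdeal_eq_iff, _root_.Units.val_one]
    have h : (FractionalIdeal.spanSingleton (𝓞 F)⁰ (u : F)) =
        (Ideal.span {(u : 𝓞 F)} : Ideal (𝓞 F)) :=
      (FractionalIdeal.coeIdeal_span_singleton _).symm
    rw [coe_unitsToField, h, Ideal.span_singleton_eq_top.mpr u.isUnit, FractionalIdeal.coeIdeal_top]

/-- The action of a field automorphism on units. -/
def unitsAut {E : Type*} [Field E] [Algebra F E] (σ : E ≃ₐ[F] E) :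
    (𝓞 E)ˣ →* (𝓞 E)ˣ :=
  _root_.Units.map (RingOfIntegers.mapRingHom (σ : E →+* E)).toMonoidHom

theorem coe_unitsAut {E : Type*} [Field E] [Algebra F E] (σ : E ≃ₐ[F] E)
    (u : (𝓞 E)ˣ) : ((unitsAut σ u : (𝓞 E)ˣ) : E) = σ (u : E) := rfl

theorem coe_iterate_unitsAut {E : Type*} [Field E] [Algebra F E] (σ : E ≃ₐ[F] E)
    (i : ℕ) (u : (𝓞 E)ˣ) : (((unitsAut σ)^[i] u : (𝓞 E)ˣ) : E) = (σ ^ i) (u : E) := by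
  induction i generalizing u with
  | zero => rfl
  | succ i ih => rw [Function.iterate_succ_apply, ih, coe_unitsAut, pow_succ]; rfl

end Units

/-! ### Norms and Hilbert 90 for cyclic extensions -/

section Galois

variable {F E : Type*} [Field F] [Field E] [Algebra F E]

theorem norm_eq_prod_range [FiniteDimensional F E] [IsGalois F E] {σ : E ≃ₐ[F] E}
    (hσ : ∀ τ, τ ∈ Subgroup.zpowers σ) (x : E) :
    algebraMap F E (Algebra.norm F x) = ∏ i ∈ Finset.range (orderOf σ), (σ ^ i) x := by
  classical
  rw [Algebra.norm_eq_prod_automorphisms, ← IsCyclic.image_range_orderOf hσ,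
    Finset.prod_image]
  intro i hi j hj h
  exact pow_injOn_Iio_orderOf (by simpa using hi) (by simpa using hj) h

theorem mem_range_algebraMap_of_fixed [FiniteDimensional F E] [IsGalois F E] {σ : E ≃ₐ[F] E}
    (hσ : ∀ τ, τ ∈ Subgroup.zpowers σ) {x : E} (hx : σ x = x) : x ∈ (algebraMap F E).range := by
  have h : ∀ τ : E ≃ₐ[F] E, τ x = x := by
    intro τ
    have h1 : σ ∈ MulAction.stabilizer (E ≃ₐ[F] E) x := hx
    exact (Subgroup.zpowers_le.mpr h1) (hσ τ)
  obtain ⟨y, hy⟩ := (IsGalois.mem_range_algebraMap_iff_fixed x).mpr h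
  exact ⟨y, hy⟩

/-- Hilbert's Theorem 90 for a cyclic group of field automorphisms. -/
theorem exists_eq_mul_apply_of_prod_eq_one {σ : E ≃ₐ[F] E} (hσ : 0 < orderOf σ) {x : E}
    (hx : ∏ i ∈ Finset.range (orderOf σ), (σ ^ i) x = 1) : ∃ y : E, y ≠ 0 ∧ y = x * σ y := by
  set n := orderOf σ with hn
  -- The solution is the resolvent `∑ c i * (σ ^ i) z`. The map w ↦ x · σ w shifts its terms by one,
  -- and the last term wraps around to the first because of `hx`. Independence of characters
  -- supplies a `z` for which the sum is nonzero.
  let c : ℕ → E := fun i => ∏ j ∈ Finset.range i, (σ ^ j) x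
  have hc : ∀ i, x * σ (c i) = c (i + 1) := by
    intro i
    simp only [c]
    rw [Finset.prod_range_succ', map_prod, pow_zero, mul_comm]
    congr 1
    refine Finset.prod_congr rfl fun j _ => ?_
    rw [pow_succ']; rfl
  have hlin : LinearIndependent E (fun i : Fin n => (fun z : E => (σ ^ (i : ℕ)) z)) := by
    have h1 := linearIndependent_monoidHom E E
    have hinj : Function.Injective (fun i : Fin n => (((σ ^ (i : ℕ) : E ≃ₐ[F] E) : E →* E))) := by
      intro i j hij
      apply Fin.ext
      apply pow_injOn_Iio_orderOf (x := σ) (Set.mem_Iio.mpr i.2) (Set.mem_Iio.mpr j.2)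
      ext z
      exact DFunLike.congr_fun hij z
    exact h1.comp _ hinj
  obtain ⟨z, hz⟩ : ∃ z : E, ∑ i ∈ Finset.range n, c i * (σ ^ i) z ≠ 0 := by
    by_contra! H
    rw [Fintype.linearIndependent_iff] at hlin
    have := hlin (fun i => c i) (by
      ext z
      rw [Finset.sum_apply, Pi.zero_apply, ← H z, Finset.sum_range]
      rfl) ⟨0, hσ⟩
    simp [c] at this
  refine ⟨_, hz, ?_⟩
  rw [map_sum, Finset.mul_sum]
  have h1 : ∀ i, x * σ (c i * (σ ^ i) z) = c (i + 1) * (σ ^ (i + 1)) z := by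
    intro i
    rw [map_mul, ← mul_assoc, hc, pow_succ']; rfl
  simp_rw [h1]
  have h2 := Finset.sum_range_succ (fun i => c i * (σ ^ i) z) n
  rw [Finset.sum_range_succ'] at h2
  have h3 : c n * (σ ^ n) z = c 0 * (σ ^ 0) z := by
    simp only [c]
    rw [hx, pow_orderOf_eq_one]; simp
  rw [h3] at h2
  exact (add_right_cancel h2).symm

end Galois

/-! ### Extension of ideals and ideal classes -/

section Principal

variable (F E : Type*) [Field F] [NumberField F] [Field E] [NumberField E] [Algebra F E]

theorem extend_toPrincipalIdeal (x : Fˣ) :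
    extend F E (toPrincipalIdeal (𝓞 F) F x) =
      toPrincipalIdeal (𝓞 E) E (Units.map (algebraMap F E).toMonoidHom x) := by
  apply Units.ext
  change FractionalIdeal.extendedHom (A := 𝓞 F) (K := F) E (𝓞 E)
    (toPrincipalIdeal (𝓞 F) F x : FractionalIdeal (𝓞 F)⁰ F) = _
  apply FractionalIdeal.coeToSubmodule_injective
  beta_reduce
  rw [FractionalIdeal.coe_extendedHom_eq_span, coe_toPrincipalIdeal, coe_toPrincipalIdeal,
    FractionalIdeal.coe_spanSingleton]
  apply le_antisymm
  · rw [Submodule.span_le]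
    rintro _ ⟨y, hy, rfl⟩
    obtain ⟨a, rfl⟩ := (FractionalIdeal.mem_spanSingleton _).mp hy
    refine Submodule.mem_span_singleton.mpr ⟨algebraMap (𝓞 F) (𝓞 E) a, ?_⟩
    rw [Algebra.smul_def, Algebra.smul_def, map_mul]
    rfl
  · rw [Submodule.span_singleton_le_iff_mem]
    exact Submodule.subset_span ⟨x, FractionalIdeal.mem_spanSingleton_self _ _, rfl⟩

theorem extend_injective : Function.Injective (extend F E) := fun _ _ h =>
  Units.ext (FractionalIdeal.extendedHom_injective (A := 𝓞 F) (K := F) E (𝓞 E)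
    (congrArg Units.val h))

variable {F E}

theorem mk_eq_one_iff_mem_principalIdeals (I : IdealGroup F) :
    ClassGroup.mk (R := 𝓞 F) (K := F) I = 1 ↔ I ∈ principalIdeals F := by
  rw [ClassGroup.mk_eq_one_iff, principalIdeals, mem_principal_ideals_iff,
    FractionalIdeal.isPrincipal_iff]
  simp only [eq_comm]

theorem ker_classGroup_mk :
    (ClassGroup.mk (R := 𝓞 F) (K := F)).ker = principalIdeals F := by
  ext I
  exact mk_eq_one_iff_mem_principalIdeals I

/-- Some positive power of every fractional ideal is principal. -/
theorem exists_pow_eq_toPrincipalIdeal (I : IdealGroup F) :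
    ∃ h : ℕ, h ≠ 0 ∧ ∃ x : Fˣ, toPrincipalIdeal (𝓞 F) F x = I ^ h := by
  refine ⟨Nat.card (ClassGroup (𝓞 F)), Nat.card_pos.ne', ?_⟩
  exact (mk_eq_one_iff_mem_principalIdeals _).mp (by rw [map_pow, pow_card_eq_one'])

theorem exists_eq_mk0_mul_toPrincipalIdeal (I : IdealGroup F) :
    ∃ (J : (Ideal (𝓞 F))⁰) (x : Fˣ),
      I = FractionalIdeal.mk0 F J * toPrincipalIdeal (𝓞 F) F x := by
  have hnum : (I : FractionalIdeal (𝓞 F)⁰ F).num ∈ (Ideal (𝓞 F))⁰ := by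
    rw [mem_nonZeroDivisors_iff_ne_zero, Ne, FractionalIdeal.num_eq_zero_iff]
    · exact I.ne_zero
  have hden : algebraMap (𝓞 F) F (I : FractionalIdeal (𝓞 F)⁰ F).den ≠ 0 := by simp
  refine ⟨⟨_, hnum⟩, (Units.mk0 _ hden)⁻¹, ?_⟩
  rw [map_inv, eq_mul_inv_iff_mul_eq]
  apply Units.ext
  rw [Units.val_mul, coe_toPrincipalIdeal, mul_comm]
  exact FractionalIdeal.den_mul_self_eq_num' _ _ _

theorem extend_mk0 (J : (Ideal (𝓞 F))⁰) :
    extend F E (FractionalIdeal.mk0 F J) =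
      FractionalIdeal.mk0 E (ClassGroup.extendedIdeal (𝓞 F) (𝓞 E) J) :=
  Units.ext (FractionalIdeal.extendedHom_coeIdeal_eq_map E (𝓞 E) (J : Ideal (𝓞 F)))

theorem extendedHom_classGroup_mk (I : IdealGroup F) :
    ClassGroup.extendedHom (𝓞 F) (𝓞 E) (ClassGroup.mk F I) = ClassGroup.mk E (extend F E I) := by
  obtain ⟨J, x, rfl⟩ := exists_eq_mk0_mul_toPrincipalIdeal I
  have h1 : ClassGroup.mk F (toPrincipalIdeal (𝓞 F) F x) = 1 :=
    (mk_eq_one_iff_mem_principalIdeals _).mpr ⟨x, rfl⟩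
  have h2 : ClassGroup.mk E (extend F E (toPrincipalIdeal (𝓞 F) F x)) = 1 := by
    rw [extend_toPrincipalIdeal]
    exact (mk_eq_one_iff_mem_principalIdeals _).mpr ⟨_, rfl⟩
  rw [map_mul, map_mul, map_mul, map_mul, h1, h2, extend_mk0, ClassGroup.mk_mk0,
    ClassGroup.mk_mk0, ClassGroup.extendedHom_mk0, map_one]

theorem extend_extend {M : Type*} [Field M] [NumberField M] [Algebra M F] [Algebra M E]
    [IsScalarTower M F E] (I : IdealGroup M) : extend F E (extend M F I) = extend M E I := by
  obtain ⟨J, x, rfl⟩ := exists_eq_mk0_mul_toPrincipalIdeal I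
  rw [map_mul, map_mul, map_mul, extend_mk0, extend_mk0, extend_mk0, extend_toPrincipalIdeal,
    extend_toPrincipalIdeal, extend_toPrincipalIdeal, ClassGroup.extendedIdeal_extendedIdeal]
  congr 2
  ext
  simp [← IsScalarTower.algebraMap_apply]

/-- If a power of a principal ideal comes from `F`, the ideal is fixed by all automorphisms. -/
theorem apply_div_self_mem_range_unitsToField {n : ℕ} (hn : n ≠ 0) {x : Eˣ}
    (hx : toPrincipalIdeal (𝓞 E) E x ^ n ∈ baseIdeals F E) (σ : E ≃ₐ[F] E) :
    Units.map (σ : E →* E) x / x ∈ (unitsToField E).range := by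
  obtain ⟨I, hI⟩ := hx
  -- With I^h = (c), the power x^(nh) is c times a unit. Hence σx/x has a power that is a unit, and
  -- so it is a unit.
  obtain ⟨h, hh, c, hc⟩ := exists_pow_eq_toPrincipalIdeal I
  have h1 : x ^ (n * h) / Units.map (algebraMap F E).toMonoidHom c ∈ (unitsToField E).range := by
    rw [← ker_toPrincipalIdeal, MonoidHom.mem_ker, map_div, map_pow, pow_mul, ← hI, ← map_pow,
      ← hc, extend_toPrincipalIdeal, div_self']
  obtain ⟨u, hu⟩ := h1
  apply mem_range_unitsToField_of_pow (mul_ne_zero hn hh)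
  refine ⟨unitsAut σ u / u, ?_⟩
  have hxu : x ^ (n * h) = unitsToField E u * Units.map (algebraMap F E).toMonoidHom c := by
    rw [hu, div_mul_cancel]
  have e1 : Units.map (σ : E →* E) (unitsToField E u) = unitsToField E (unitsAut σ u) := by
    ext; rfl
  have e2 : Units.map (σ : E →* E) (Units.map (algebraMap F E).toMonoidHom c) =
      Units.map (algebraMap F E).toMonoidHom c := by
    ext; exact σ.commutes c
  rw [div_pow, ← map_pow, hxu, map_mul, e1, e2, mul_div_mul_right_eq_div, map_div]

end Principal

/-! ### Ambiguous principal ideals and the cohomology of units -/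

section Cyclic

variable (F E : Type*) [Field F] [Field E] [Algebra F E]

/-- The map `U_F → U_E`. -/
def unitsExtend : (𝓞 F)ˣ →* (𝓞 E)ˣ := Units.map (algebraMap (𝓞 F) (𝓞 E)).toMonoidHom

/-- The group of norms of units of `E`. -/
noncomputable def unitNorms [NumberField F] [NumberField E] : Subgroup (𝓞 F)ˣ :=
  (Units.map (RingOfIntegers.norm F : 𝓞 E →* 𝓞 F)).range

variable {F E}

theorem unitsExtend_injective : Function.Injective (unitsExtend F E) := fun _ _ h => by
  apply Units.coe_injective F
  apply (algebraMap F E).injective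
  exact congrArg (fun x : (𝓞 E)ˣ => (x : E)) h

theorem coe_units_prod {E : Type*} [Field E] {ι : Type*} (s : Finset ι) (f : ι → (𝓞 E)ˣ) :
    ((∏ i ∈ s, f i : (𝓞 E)ˣ) : E) = ∏ i ∈ s, (f i : E) := by
  rw [Units.coe_prod, map_prod]

variable [NumberField F] [NumberField E] [IsGalois F E] {p : ℕ} {σ : E ≃ₐ[F] E}

theorem coe_unitsExtend_norm (hσ : ∀ τ, τ ∈ Subgroup.zpowers σ) (hp : orderOf σ = p) (u : (𝓞 E)ˣ) :
    ((unitsExtend F E (Units.map (RingOfIntegers.norm F : 𝓞 E →* 𝓞 F) u) : (𝓞 E)ˣ) : E) =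
      ∏ i ∈ Finset.range p, (σ ^ i) (u : E) := by
  rw [← hp, ← norm_eq_prod_range hσ]
  rfl

/-- The Herbrand quotient of the units in a cyclic extension of prime degree. -/
theorem herbrand_quotient_units [IsTotallyReal F] [IsTotallyReal E] (hp : p.Prime) (hp2 : p ≠ 2)
    (hdeg : finrank F E = p) (hσ : ∀ τ, τ ∈ Subgroup.zpowers σ) (hord : orderOf σ = p)
    (δ ν : (𝓞 E)ˣ →* (𝓞 E)ˣ) (hδ : ∀ v, δ v = unitsAut σ v / v)
    (hν : ∀ v, ν v = unitsExtend F E (Units.map (RingOfIntegers.norm F : 𝓞 E →* 𝓞 F) v)) :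
    (unitNorms F E).index ∣ p ^ Units.rank F ∧
      δ.range.relIndex ν.ker = p * (unitNorms F E).index := by
  have hodd := hp.odd_of_ne_two hp2
  have hker : δ.ker = (unitsExtend F E).range := by
    ext u
    rw [MonoidHom.mem_ker, hδ, div_eq_one]
    constructor
    · intro h
      have h1 : σ (u : E) = u := by
        rw [← coe_unitsAut, h]
      obtain ⟨y, hy⟩ := mem_range_algebraMap_of_fixed hσ h1
      have hy0 : y ≠ 0 := by
        rintro rfl
        exact Units.coe_ne_zero u (by rw [← hy, map_zero])
      have hu : unitsToField E u = Units.map (algebraMap F E).toMonoidHom (Units.mk0 y hy0) := by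
        ext; exact hy.symm
      have h2 : Units.mk0 y hy0 ∈ (unitsToField F).range := by
        have h3 := mem_range_unitsToField_iff.mp ⟨u, hu⟩
        rw [mem_range_unitsToField_iff]
        refine ⟨(isIntegral_algebraMap_iff (algebraMap F E).injective).mp h3.1,
          (isIntegral_algebraMap_iff (algebraMap F E).injective).mp ?_⟩
        rw [← map_inv] at h3
        exact h3.2
      obtain ⟨v, hv⟩ := h2
      refine ⟨v, unitsToField_injective ?_⟩
      rw [hu, ← hv]
      ext; rfl
    · rintro ⟨v, rfl⟩
      apply Units.coe_injective E
      exact σ.commutes v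
  have hcomm : ∀ (H : Subgroup (𝓞 F)ˣ), (H.map (unitsExtend F E)).relIndex δ.ker = H.index := by
    intro H
    rw [hker, MonoidHom.range_eq_map, Subgroup.relIndex_map_map_of_injective _ _
      unitsExtend_injective, Subgroup.relIndex_top_right]
  have hA : (δ.ker.map (powMonoidHom p)).relIndex δ.ker = p ^ Units.rank F := by
    rw [← index_range_pow_units F hodd, ← hcomm]
    congr 1
    rw [hker]
    ext u
    constructor
    · rintro ⟨_, ⟨v, rfl⟩, rfl⟩
      exact ⟨_, ⟨v, rfl⟩, map_pow _ v p⟩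
    · rintro ⟨_, ⟨v, rfl⟩, rfl⟩
      exact ⟨_, ⟨v, rfl⟩, (map_pow _ v p).symm⟩
  -- For n = [F:ℚ] this reads pn - 1 = (n - 1) + (p - 1)n. The Herbrand quotient is thus applied
  -- with r = n - 1 and t = n, which is the source of the factor p = p^t / p^r.
  have hrank : Units.rank E = Units.rank F + (p - 1) * finrank ℚ F := by
    have h1 := units_rank_add_one E
    have h2 := units_rank_add_one F
    have h3 := finrank_mul_finrank ℚ F E
    rw [hdeg] at h3
    obtain ⟨q, rfl⟩ : ∃ q, p = q + 1 := ⟨p - 1, (Nat.sub_add_cancel hp.one_le).symm⟩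
    rw [Nat.add_sub_cancel]
    nlinarith
  have hV := index_range_pow_units E hodd
  rw [hrank] at hV
  have hnu : ν.range = (unitNorms F E).map (unitsExtend F E) := by
    ext u
    constructor
    · rintro ⟨v, rfl⟩
      exact ⟨_, ⟨v, rfl⟩, (hν v).symm⟩
    · rintro ⟨_, ⟨v, rfl⟩, rfl⟩
      exact ⟨v, hν v⟩
  obtain ⟨h1, h2⟩ := herbrand_quotient_mul hp (unitsAut σ) (fun v => by
      apply Units.coe_injective E
      change (((unitsAut σ)^[p] v : (𝓞 E)ˣ) : E) = v
      rw [coe_iterate_unitsAut, ← hord, pow_orderOf_eq_one]; rfl)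
    (fun v hv => by
      apply Units.coe_injective E
      change (v : E) = ((1 : (𝓞 E)ˣ) : E)
      rw [Units.coe_one]
      apply eq_one_of_pow_eq_one_of_odd hodd
      rw [← Units.coe_pow, hv, Units.coe_one]) δ ν hδ
    (fun v => by
      apply Units.coe_injective E
      change ((ν v : (𝓞 E)ˣ) : E) = ((∏ i ∈ Finset.range p, (unitsAut σ)^[i] v : (𝓞 E)ˣ) : E)
      rw [hν, coe_unitsExtend_norm hσ hord, coe_units_prod]
      simp_rw [coe_iterate_unitsAut]) hA hV
  rw [hnu, hcomm] at h1 h2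
  refine ⟨h1, ?_⟩
  apply Nat.eq_of_mul_eq_mul_right (pow_pos hp.pos (Units.rank F))
  rw [h2, ← units_rank_add_one F, pow_succ]
  ring

/-- The ideal (x) equals each of its p conjugates, and their product is generated by the norm of x.
-/
theorem toPrincipalIdeal_pow_eq_of_fixed (hσ : ∀ τ, τ ∈ Subgroup.zpowers σ) (hord : orderOf σ = p)
    {x : Eˣ} (hx : Units.map (σ : E →* E) x / x ∈ (unitsToField E).range) :
    toPrincipalIdeal (𝓞 E) E x ^ p ∈ basePrincipalIdeals F E := by
  have h1 : toPrincipalIdeal (𝓞 E) E (Units.map (σ : E →* E) x) = toPrincipalIdeal (𝓞 E) E x := by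
    rw [← ker_toPrincipalIdeal, MonoidHom.mem_ker, map_div, div_eq_one] at hx
    exact hx
  have hstep : ∀ y : Eˣ, toPrincipalIdeal (𝓞 E) E y = toPrincipalIdeal (𝓞 E) E x →
      toPrincipalIdeal (𝓞 E) E (Units.map (σ : E →* E) y) = toPrincipalIdeal (𝓞 E) E x := by
    intro y hy
    rw [← div_eq_one, ← map_div, ← MonoidHom.mem_ker, ker_toPrincipalIdeal] at hy
    obtain ⟨u, hu⟩ := hy
    rw [← h1, ← div_eq_one, ← map_div, ← map_div, ← hu, ← MonoidHom.mem_ker, ker_toPrincipalIdeal]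
    exact ⟨unitsAut σ u, by ext; rfl⟩
  have h2 : ∀ i : ℕ, toPrincipalIdeal (𝓞 E) E (Units.map ((σ ^ i : E ≃ₐ[F] E) : E →* E) x) =
      toPrincipalIdeal (𝓞 E) E x := by
    intro i
    induction i with
    | zero => congr 1
    | succ i ih =>
      rw [← hstep _ ih, pow_succ']
      congr 1
  have hN : Algebra.norm F (x : E) ≠ 0 := Algebra.norm_ne_zero_iff.mpr x.ne_zero
  refine ⟨toPrincipalIdeal (𝓞 F) F (Units.mk0 _ hN), ⟨_, rfl⟩, ?_⟩
  rw [extend_toPrincipalIdeal]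
  have h3 : Units.map (algebraMap F E).toMonoidHom (Units.mk0 _ hN) =
      ∏ i ∈ Finset.range p, Units.map ((σ ^ i : E ≃ₐ[F] E) : E →* E) x := by
    ext
    rw [Units.coe_prod]
    exact (norm_eq_prod_range hσ _).trans (by rw [hord]; rfl)
  rw [h3, map_prod]
  simp_rw [h2]
  rw [Finset.prod_const, Finset.card_range]

variable (F E) in
theorem exists_generator_of_finrank_eq_prime (hp : p.Prime) (hdeg : finrank F E = p) :
    ∃ σ : E ≃ₐ[F] E, (∀ τ, τ ∈ Subgroup.zpowers σ) ∧ orderOf σ = p := by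
  have hcard : Nat.card (E ≃ₐ[F] E) = p := by rw [IsGalois.card_aut_eq_finrank, hdeg]
  have : Fact p.Prime := ⟨hp⟩
  obtain ⟨σ, hσ1⟩ : ∃ σ : E ≃ₐ[F] E, σ ≠ 1 := by
    have : Nontrivial (E ≃ₐ[F] E) := by
      rw [← Finite.one_lt_card_iff_nontrivial, hcard]; exact hp.one_lt
    exact exists_ne 1
  have hσ : ∀ τ, τ ∈ Subgroup.zpowers σ := fun τ => mem_zpowers_of_prime_card hcard hσ1
  exact ⟨σ, hσ, by rw [orderOf_eq_card_of_forall_mem_zpowers hσ, hcard]⟩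

/-- Let X be the group of x for which (x) is ambiguous. The order of X/(F^× U_E) is computed twice.
The map x ↦ (x) has kernel U_E and yields P_{E/F}/P_F. The map x ↦ σx/x has kernel F^×, takes X onto
the units of norm 1 by Hilbert 90, and takes U_E onto the units σu/u. -/
theorem relIndex_ambiguousPrincipalIdeals [IsTotallyReal F] [IsTotallyReal E] (hp : p.Prime)
    (hp2 : p ≠ 2) (hdeg : finrank F E = p) :
    (unitNorms F E).index ∣ p ^ Units.rank F ∧
      (basePrincipalIdeals F E).relIndex (ambiguousPrincipalIdeals F E p) =
        p * (unitNorms F E).index := by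
  obtain ⟨σ, hσ, hord⟩ := exists_generator_of_finrank_eq_prime F E hp hdeg
  let δ : (𝓞 E)ˣ →* (𝓞 E)ˣ := unitsAut σ / MonoidHom.id _
  let ν : (𝓞 E)ˣ →* (𝓞 E)ˣ :=
    (unitsExtend F E).comp (Units.map (RingOfIntegers.norm F : 𝓞 E →* 𝓞 F))
  obtain ⟨h1, h2⟩ := herbrand_quotient_units hp hp2 hdeg hσ hord δ ν (fun _ => rfl) (fun _ => rfl)
  refine ⟨h1, ?_⟩
  rw [← h2]
  let π := toPrincipalIdeal (𝓞 E) E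
  let j := unitsToField E
  let k : Fˣ →* Eˣ := Units.map (algebraMap F E).toMonoidHom
  let Δ : Eˣ →* Eˣ := Units.map (σ : E →* E) / MonoidHom.id _
  have hΔ : ∀ x, Δ x = Units.map (σ : E →* E) x / x := fun _ => rfl
  have hπker : π.ker = j.range := ker_toPrincipalIdeal
  let X : Subgroup Eˣ := (ambiguousPrincipalIdeals F E p).comap π
  have hX : X.map π = ambiguousPrincipalIdeals F E p :=
    Subgroup.map_comap_eq_self inf_le_right
  have hXmem : ∀ x, x ∈ X ↔ Δ x ∈ j.range := by
    intro x
    constructor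
    · rintro ⟨hx, -⟩
      exact apply_div_self_mem_range_unitsToField hp.ne_zero hx σ
    · intro hx
      exact ⟨Subgroup.map_le_range _ _ (toPrincipalIdeal_pow_eq_of_fixed hσ hord hx), ⟨x, rfl⟩⟩
  have hbase : k.range.map π = basePrincipalIdeals F E := by
    ext I
    constructor
    · rintro ⟨_, ⟨x, rfl⟩, rfl⟩
      exact ⟨_, ⟨x, rfl⟩, extend_toPrincipalIdeal F E x⟩
    · rintro ⟨_, ⟨x, rfl⟩, rfl⟩
      exact ⟨_, ⟨x, rfl⟩, (extend_toPrincipalIdeal F E x).symm⟩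
  have hΔker : Δ.ker = k.range := by
    ext x
    rw [MonoidHom.mem_ker, hΔ, div_eq_one]
    constructor
    · intro hx
      obtain ⟨y, hy⟩ := mem_range_algebraMap_of_fixed hσ (congrArg Units.val hx)
      have hy0 : y ≠ 0 := by
        rintro rfl
        exact x.ne_zero (by rw [← hy, map_zero])
      exact ⟨Units.mk0 y hy0, by ext; exact hy⟩
    · rintro ⟨y, rfl⟩
      ext; exact σ.commutes y
  have hkX : Δ.ker ≤ X := by
    intro x hx
    rw [hXmem, MonoidHom.mem_ker.mp hx]
    exact one_mem _
  have hjX : j.range ≤ X := by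
    rw [← hπker]; exact MonoidHom.ker_le_comap _ _
  have hj : j.range.map Δ = δ.range.map j := by
    have : ∀ u, Δ (j u) = j (δ u) := by
      intro u
      rw [hΔ]
      change _ = j (unitsAut σ u / u)
      rw [map_div]
      congr 1
    ext x
    constructor
    · rintro ⟨_, ⟨u, rfl⟩, rfl⟩
      exact ⟨_, ⟨u, rfl⟩, (this u).symm⟩
    · rintro ⟨_, ⟨u, rfl⟩, rfl⟩
      exact ⟨_, ⟨u, rfl⟩, this u⟩
  have hνone : ∀ u, u ∈ ν.ker ↔ Algebra.norm F ((u : 𝓞 E) : E) = 1 := by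
    intro u
    have e : ((ν u : (𝓞 E)ˣ) : E) = algebraMap F E (Algebra.norm F ((u : 𝓞 E) : E)) := rfl
    rw [MonoidHom.mem_ker]
    constructor
    · intro h
      apply (algebraMap F E).injective
      rw [← e, h, map_one]; rfl
    · intro h
      apply Units.coe_injective E
      change ((ν u : (𝓞 E)ˣ) : E) = _
      rw [e, h, map_one]; rfl
  have hXΔ : X.map Δ = ν.ker.map j := by
    ext x
    constructor
    · rintro ⟨x, hx, rfl⟩
      obtain ⟨u, hu⟩ := (hXmem x).mp hx
      refine ⟨u, ?_, hu⟩
      have h : ((u : 𝓞 E) : E) = σ (x : E) / x := by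
        change ((j u : Eˣ) : E) = _
        rw [hu, hΔ, Units.val_div_eq_div_val]; rfl
      rw [SetLike.mem_coe, hνone]
      apply mul_right_cancel₀ (Algebra.norm_ne_zero_iff (R := F).mpr x.ne_zero)
      rw [← map_mul, h, div_mul_cancel₀ _ x.ne_zero, Algebra.norm_eq_of_algEquiv, one_mul]
    · rintro ⟨u, hu, rfl⟩
      -- The inverse enters because y = u⁻¹ · σy is the equation σy/y = u.
      have hu' := (hνone _).mp (ν.ker.inv_mem hu)
      obtain ⟨y, hy0, hy⟩ := exists_eq_mul_apply_of_prod_eq_one (σ := σ)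
        (x := ((u⁻¹ : (𝓞 E)ˣ) : E)) (by rw [hord]; exact hp.pos)
        (by rw [← norm_eq_prod_range hσ, hu', map_one])
      have hΔy : Δ (Units.mk0 y hy0) = j u := by
        rw [hΔ, div_eq_iff_eq_mul, ← inv_mul_eq_iff_eq_mul, ← map_inv]
        ext
        exact hy.symm
      exact ⟨Units.mk0 y hy0, (hXmem _).mpr ⟨u, hΔy.symm⟩, hΔy⟩
  rw [← hX, ← hbase, Subgroup.relIndex_map_map, hπker, sup_eq_left.mpr hjX,
    ← Subgroup.relIndex_map_map_of_injective _ _ (unitsToField_injective (F := E))]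
  change _ = (δ.range.map j).relIndex (ν.ker.map j)
  rw [← hj, ← hXΔ, Subgroup.relIndex_map_map, sup_eq_left.mpr hkX, hΔker, sup_comm]

end Cyclic

/-! ### Capitulation kernel inside the ambiguous principal ideals -/

section Capitulation

variable (F E : Type*) [Field F] [NumberField F] [Field E] [NumberField E] [Algebra F E]

theorem baseIdeals_le_ambiguousIdeals (p : ℕ) : baseIdeals F E ≤ ambiguousIdeals F E p :=
  fun _ hx => pow_mem hx p

theorem map_comap_principalIdeals_mk :
    ((principalIdeals E).comap (extend F E)).map (ClassGroup.mk (R := 𝓞 F) (K := F)) =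
      (ClassGroup.extendedHom (𝓞 F) (𝓞 E)).ker := by
  ext c
  constructor
  · rintro ⟨I, hI, rfl⟩
    rw [MonoidHom.mem_ker, extendedHom_classGroup_mk (E := E), mk_eq_one_iff_mem_principalIdeals]
    exact hI
  · intro hc
    obtain ⟨I, rfl⟩ : ∃ I, ClassGroup.mk F I = c :=
      ClassGroup.induction (P := fun c => ∃ I, ClassGroup.mk F I = c) (K := F)
        (fun I => ⟨I, rfl⟩) c
    refine ⟨I, ?_, rfl⟩
    rw [MonoidHom.mem_ker, extendedHom_classGroup_mk (E := E),
      mk_eq_one_iff_mem_principalIdeals] at hc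
    exact hc

/-- The kernel consists of the ideals of F that become principal in E, modulo P_F; since extension
of ideals is injective, the count can be made inside I_E. -/
theorem card_ker_extendedHom :
    Nat.card (ClassGroup.extendedHom (𝓞 F) (𝓞 E)).ker =
      (basePrincipalIdeals F E).relIndex (baseIdeals F E ⊓ principalIdeals E) := by
  rw [← map_comap_principalIdeals_mk, ← Subgroup.relIndex_ker, ker_classGroup_mk,
    ← Subgroup.relIndex_map_map_of_injective _ _ (extend_injective F E),
    Subgroup.map_comap_eq]
  rfl

variable {F E}

/-- If I becomes principal with generator x, then I^p is generated by the norm of x. -/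
theorem pow_eq_one_of_mem_ker_extendedHom [IsGalois F E] {p : ℕ} (hp : p.Prime)
    (hdeg : finrank F E = p) (c : (ClassGroup.extendedHom (𝓞 F) (𝓞 E)).ker) : c ^ p = 1 := by
  obtain ⟨σ, hσ, hord⟩ := exists_generator_of_finrank_eq_prime F E hp hdeg
  obtain ⟨c, hc⟩ := c
  rw [← map_comap_principalIdeals_mk] at hc
  obtain ⟨I, ⟨x, hx⟩, rfl⟩ := hc
  apply Subtype.ext
  change ClassGroup.mk F I ^ p = 1
  rw [← map_pow, mk_eq_one_iff_mem_principalIdeals]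
  have h1 : toPrincipalIdeal (𝓞 E) E x ^ 1 ∈ baseIdeals F E := by
    rw [pow_one, hx]; exact ⟨I, rfl⟩
  obtain ⟨J, hJ, hJx⟩ := toPrincipalIdeal_pow_eq_of_fixed hσ hord
    (apply_div_self_mem_range_unitsToField one_ne_zero h1 σ)
  rw [hx, ← map_pow] at hJx
  rw [← extend_injective F E hJx]
  exact hJ

/-- The chain P_F ≤ I_F ∩ P_E ≤ P_{E/F}, with the second isomorphism theorem for its upper step. -/
theorem relIndex_ambiguousPrincipalIdeals_eq_mul (p : ℕ) :
    (basePrincipalIdeals F E).relIndex (ambiguousPrincipalIdeals F E p) =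
      Nat.card (ClassGroup.extendedHom (𝓞 F) (𝓞 E)).ker *
        (baseIdeals F E).relIndex (ambiguousPrincipalIdeals F E p ⊔ baseIdeals F E) := by
  have h : baseIdeals F E ⊓ principalIdeals E =
      baseIdeals F E ⊓ ambiguousPrincipalIdeals F E p := by
    rw [ambiguousPrincipalIdeals, ← inf_assoc,
      inf_eq_left.mpr (baseIdeals_le_ambiguousIdeals F E p)]
  rw [card_ker_extendedHom, Subgroup.relIndex_sup_right, h, Subgroup.relIndex_inf_mul_relIndex]
  congr 1
  exact (inf_eq_left.mpr (Subgroup.map_le_range _ _)).symm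

end Capitulation

/-! ### Compatibility of ideal norms with extension of ideals -/

section Norm

variable (F E : Type*) [Field F] [NumberField F] [Field E] [NumberField E] [Algebra F E]

theorem coe_intNorm (x : 𝓞 E) :
    algebraMap (𝓞 F) F (Algebra.intNorm (𝓞 F) (𝓞 E) x) = Algebra.norm F (x : E) :=
  Algebra.algebraMap_intNorm (L := E) x

theorem idealNorm_toPrincipalIdeal (x : Eˣ) :
    idealNorm F E (toPrincipalIdeal (𝓞 E) E x) =
      toPrincipalIdeal (𝓞 F) F (Units.map (Algebra.norm F : E →* F) x) := by
  apply Units.ext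
  obtain ⟨a, d, hd, hx⟩ := IsFractionRing.div_surjective (A := 𝓞 E) (x : E)
  have hd0 : (d : 𝓞 E) ≠ 0 := nonZeroDivisors.ne_zero hd
  change relNormFun F E (toPrincipalIdeal (𝓞 E) E x : FractionalIdeal (𝓞 E)⁰ E) = _
  rw [coe_toPrincipalIdeal, coe_toPrincipalIdeal,
    relNormFun_eq F E (J := Ideal.span {a}) (D := Ideal.span {d}) (by simpa using hd0),
    Ideal.relNorm_singleton, Ideal.relNorm_singleton, FractionalIdeal.coeIdeal_span_singleton,
    FractionalIdeal.coeIdeal_span_singleton, coe_intNorm, coe_intNorm,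
    FractionalIdeal.spanSingleton_div_spanSingleton]
  · congr 1
    change _ = Algebra.norm F (x : E)
    rw [div_eq_iff (Algebra.norm_ne_zero_iff.mpr (RingOfIntegers.coe_ne_zero_iff.mpr hd0)),
      ← map_mul, ← hx, div_mul_cancel₀ _ (RingOfIntegers.coe_ne_zero_iff.mpr hd0)]
  · rw [FractionalIdeal.coeIdeal_span_singleton, FractionalIdeal.coeIdeal_span_singleton,
      FractionalIdeal.spanSingleton_mul_spanSingleton, ← hx, mul_div_cancel₀]
    simpa using hd0

theorem coe_idealNorm_mk0 (J : (Ideal (𝓞 E))⁰) :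
    (idealNorm F E (FractionalIdeal.mk0 E J) : FractionalIdeal (𝓞 F)⁰ F) =
      (Ideal.relNorm (𝓞 F) (J : Ideal (𝓞 E)) : FractionalIdeal (𝓞 F)⁰ F) := by
  change relNormFun F E (FractionalIdeal.mk0 E J : FractionalIdeal (𝓞 E)⁰ E) = _
  rw [relNormFun_eq F E (J := J) (D := ⊤) (by simp) (by simp)]
  simp

variable {F E} {M L : Type*} [Field M] [NumberField M] [Field L] [NumberField L]
  [Algebra M F] [Algebra M L] [Algebra L E]

theorem algebraMap_intNorm_eq_intNorm_algebraMap
    (h : ∀ x : F, Algebra.norm L (algebraMap F E x) = algebraMap M L (Algebra.norm M x))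
    (x : 𝓞 F) : algebraMap (𝓞 M) (𝓞 L) (Algebra.intNorm (𝓞 M) (𝓞 F) x) =
      Algebra.intNorm (𝓞 L) (𝓞 E) (algebraMap (𝓞 F) (𝓞 E) x) :=
  RingOfIntegers.ext ((congrArg (algebraMap M L) (coe_intNorm M F x)).trans
    ((h x).symm.trans (coe_intNorm L E (algebraMap (𝓞 F) (𝓞 E) x)).symm))

theorem map_relNorm_le_relNorm_map
    (h : ∀ x : F, Algebra.norm L (algebraMap F E x) = algebraMap M L (Algebra.norm M x))
    (J : Ideal (𝓞 F)) :
    (Ideal.relNorm (𝓞 M) J).map (algebraMap (𝓞 M) (𝓞 L)) ≤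
      Ideal.relNorm (𝓞 L) (J.map (algebraMap (𝓞 F) (𝓞 E))) := by
  rw [Ideal.map_relNorm, Ideal.span_le]
  rintro _ ⟨x, hx, rfl⟩
  change algebraMap (𝓞 M) (𝓞 L) (Algebra.intNorm (𝓞 M) (𝓞 F) x) ∈ _
  rw [algebraMap_intNorm_eq_intNorm_algebraMap h]
  exact Ideal.intNorm_mem_spanNorm _ (Ideal.mem_map_of_mem _ hx)

/-- The inclusion visible on generators holds for J and for a cofactor J' with J J' = (b). For the
principal ideal (b) equality follows from `h`, and cancelling the norm of J' forces equality for J.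
-/
theorem relNorm_map_eq_map_relNorm
    (h : ∀ x : F, Algebra.norm L (algebraMap F E x) = algebraMap M L (Algebra.norm M x))
    {J : Ideal (𝓞 F)} (hJ : J ≠ ⊥) :
    Ideal.relNorm (𝓞 L) (J.map (algebraMap (𝓞 F) (𝓞 E))) =
      (Ideal.relNorm (𝓞 M) J).map (algebraMap (𝓞 M) (𝓞 L)) := by
  refine le_antisymm ?_ (map_relNorm_le_relNorm_map h J)
  obtain ⟨b, hb, hb0⟩ := Submodule.exists_mem_ne_zero_of_ne_bot hJ
  obtain ⟨J', hJ'⟩ : J ∣ Ideal.span {b} := Ideal.dvd_span_singleton.mpr hb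
  have hprin : Ideal.relNorm (𝓞 L) ((Ideal.span {b}).map (algebraMap (𝓞 F) (𝓞 E))) ≤
      (Ideal.relNorm (𝓞 M) (Ideal.span {b})).map (algebraMap (𝓞 M) (𝓞 L)) := by
    rw [Ideal.map_span, Set.image_singleton, Ideal.relNorm_singleton, Ideal.relNorm_singleton,
      Ideal.map_span, Set.image_singleton]
    rw [algebraMap_intNorm_eq_intNorm_algebraMap h]
  have hJ'0 : Ideal.relNorm (𝓞 L) (J'.map (algebraMap (𝓞 F) (𝓞 E))) ≠ 0 := by
    rw [Ne, Ideal.zero_eq_bot, Ideal.relNorm_eq_bot_iff,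
      Ideal.map_eq_bot_iff_of_injective (FaithfulSMul.algebraMap_injective _ _)]
    rintro rfl
    rw [Ideal.mul_bot, Ideal.span_singleton_eq_bot] at hJ'
    exact hb0 hJ'
  rw [← Ideal.dvd_iff_le, ← mul_dvd_mul_iff_right hJ'0, ← map_mul, ← Ideal.map_mul, ← hJ',
    Ideal.dvd_iff_le]
  refine hprin.trans ?_
  rw [hJ', map_mul, Ideal.map_mul]
  exact Ideal.mul_mono_right (map_relNorm_le_relNorm_map h J')

theorem idealNorm_extend
    (h : ∀ x : F, Algebra.norm L (algebraMap F E x) = algebraMap M L (Algebra.norm M x))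
    (I : IdealGroup F) : idealNorm L E (extend F E I) = extend M L (idealNorm M F I) := by
  obtain ⟨J, x, rfl⟩ := exists_eq_mk0_mul_toPrincipalIdeal I
  rw [map_mul, map_mul, map_mul, map_mul, extend_toPrincipalIdeal, idealNorm_toPrincipalIdeal,
    idealNorm_toPrincipalIdeal, extend_toPrincipalIdeal]
  congr 1
  · apply Units.ext
    rw [extend_mk0, coe_idealNorm_mk0]
    change _ = FractionalIdeal.extendedHom (A := 𝓞 M) (K := M) L (𝓞 L)
      (idealNorm M F (FractionalIdeal.mk0 F J) : FractionalIdeal (𝓞 M)⁰ M)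
    rw [coe_idealNorm_mk0, FractionalIdeal.extendedHom_coeIdeal_eq_map]
    congr 1
    exact relNorm_map_eq_map_relNorm h (nonZeroDivisors.ne_zero J.2)
  · congr 1
    ext
    exact h x

end Norm

/-! ### Ideals of ℚ are principal -/

section Rat

theorem principalIdeals_rat : principalIdeals ℚ = ⊤ := by
  rw [eq_top_iff]
  intro I _
  rw [← mk_eq_one_iff_mem_principalIdeals]
  have : IsPrincipalIdealRing (𝓞 ℚ) := IsPrincipalIdealRing.of_surjective
    Rat.ringOfIntegersEquiv.symm.toRingHom Rat.ringOfIntegersEquiv.symm.surjective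
  exact Subsingleton.elim _ _

theorem basePrincipalIdeals_rat (L : Type*) [Field L] [NumberField L] :
    basePrincipalIdeals ℚ L = baseIdeals ℚ L := by
  rw [basePrincipalIdeals, principalIdeals_rat, baseIdeals, MonoidHom.range_eq_map]

end Rat

/-! ### Splitting principal factors by the norm from N to L -/

section Dihedral

variable {p : ℕ} {N : Type*} [Field N] [NumberField N] {K L : IntermediateField ℚ N}

theorem finrank_right_eq {m n : ℕ} (hm : m ≠ 0) (hN : finrank ℚ N = m * n) (hK : finrank ℚ K = m) :
    finrank K N = n := by
  have h := finrank_mul_finrank ℚ K N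
  rw [hN, hK] at h
  exact Nat.eq_of_mul_eq_mul_left (Nat.pos_of_ne_zero hm) h

/-- The coprime degrees 2 and p make K and L linearly disjoint with compositum N. -/
theorem norm_algebraMap_of_finrank (hp : p.Prime) (hp2 : p ≠ 2) (hN : finrank ℚ N = 2 * p)
    (hK : finrank ℚ K = 2) (hL : finrank ℚ L = p) (x : K) :
    Algebra.norm L (algebraMap K N x) = algebraMap ℚ L (Algebra.norm ℚ x) := by
  have h1 : L.LinearDisjoint K := IntermediateField.LinearDisjoint.of_finrank_coprime (by
    rw [hL, hK, Nat.coprime_primes hp Nat.prime_two]; exact hp2)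
  refine h1.norm_algebraMap ?_ x
  apply IntermediateField.eq_of_le_of_finrank_eq le_top
  rw [h1.finrank_sup, hL, hK, IntermediateField.finrank_top', hN, mul_comm]

theorem idealNorm_mem_baseIdeals (hp : p.Prime) (hp2 : p ≠ 2) (hN : finrank ℚ N = 2 * p)
    (hK : finrank ℚ K = 2) (hL : finrank ℚ L = p) {I : IdealGroup N} (hI : I ∈ baseIdeals K N) :
    idealNorm L N I ∈ baseIdeals ℚ L := by
  obtain ⟨J, rfl⟩ := hI
  exact ⟨_, (idealNorm_extend (norm_algebraMap_of_finrank hp hp2 hN hK hL) J).symm⟩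

theorem idealNorm_extend_principal (hL2 : finrank L N = 2) (x : Lˣ) :
    idealNorm L N (extend L N (toPrincipalIdeal (𝓞 L) L x)) = toPrincipalIdeal (𝓞 L) L x ^ 2 := by
  rw [extend_toPrincipalIdeal, idealNorm_toPrincipalIdeal, ← map_pow]
  congr 1
  ext1
  exact (Algebra.norm_algebraMap (x : L)).trans (by rw [hL2]; rfl)

variable (p N K L) in
theorem map_idealNorm_sup (hp : p.Prime) (hp2 : p ≠ 2) (hN : finrank ℚ N = 2 * p)
    (hK : finrank ℚ K = 2) (hL : finrank ℚ L = p) :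
    (ambiguousPrincipalIdeals K N p ⊔ baseIdeals K N).map (idealNorm L N) ⊔ baseIdeals ℚ L =
      ambiguousPrincipalIdeals ℚ L p := by
  have hbase : baseIdeals ℚ L ≤ ambiguousPrincipalIdeals ℚ L p := by
    refine le_inf (baseIdeals_le_ambiguousIdeals ℚ L p) ?_
    rw [← basePrincipalIdeals_rat]
    rintro _ ⟨_, ⟨x, rfl⟩, rfl⟩
    exact ⟨_, (extend_toPrincipalIdeal ℚ L x).symm⟩
  apply le_antisymm
  · refine sup_le ?_ hbase
    rw [Subgroup.map_sup]
    refine sup_le ?_ ?_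
    · rintro _ ⟨_, ⟨hx, ⟨x, rfl⟩⟩, rfl⟩
      refine ⟨?_, ?_⟩
      · change idealNorm L N _ ^ p ∈ baseIdeals ℚ L
        rw [← map_pow]
        exact idealNorm_mem_baseIdeals hp hp2 hN hK hL hx
      · exact ⟨_, (idealNorm_toPrincipalIdeal L N x).symm⟩
    · rintro _ ⟨x, hx, rfl⟩
      exact hbase (idealNorm_mem_baseIdeals hp hp2 hN hK hL hx)
  · rintro _ ⟨hx, ⟨x, rfl⟩⟩
    obtain ⟨k, hk⟩ := hp.odd_of_ne_two hp2
    have hL2 : finrank L N = 2 := finrank_right_eq hp.ne_zero (by rw [hN, mul_comm]) hL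
    -- With p = 2k + 1, the norm of (x^(k+1)) is (x)^(2k+2) = (x) · (x)^p, and (x)^p comes from ℚ.
    have e : toPrincipalIdeal (𝓞 L) L x =
        idealNorm L N (extend L N (toPrincipalIdeal (𝓞 L) L (x ^ (k + 1)))) *
          (toPrincipalIdeal (𝓞 L) L x ^ p)⁻¹ := by
      rw [idealNorm_extend_principal hL2, eq_mul_inv_iff_mul_eq, map_pow, ← pow_mul, ← pow_succ',
        hk]
      congr 1; omega
    rw [e]
    refine Subgroup.mul_mem_sup (Subgroup.mem_map_of_mem _ (Subgroup.mem_sup_left ?_))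
      (inv_mem hx)
    obtain ⟨I, hI⟩ := hx
    refine ⟨⟨extend ℚ K I ^ (k + 1), ?_⟩, ?_⟩
    · have hI' : extend ℚ L I = toPrincipalIdeal (𝓞 L) L x ^ p := hI
      have hx' : toPrincipalIdeal (𝓞 L) L (x ^ (k + 1)) ^ p = extend ℚ L I ^ (k + 1) := by
        rw [hI', map_pow, pow_right_comm]
      change _ = extend L N _ ^ p
      rw [← map_pow (extend L N), hx', map_pow, map_pow, extend_extend, extend_extend]
    · exact ⟨_, (extend_toPrincipalIdeal L N _).symm⟩

-- The first isomorphism theorem for the norm modulo ideals from ℚ: the kernel gives the relative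
-- factors, and `map_idealNorm_sup` identifies the image with the absolute ones.
variable (p N K L) in
theorem relIndex_ambiguousPrincipalIdeals_sup (hp : p.Prime) (hp2 : p ≠ 2)
    (hN : finrank ℚ N = 2 * p) (hK : finrank ℚ K = 2) (hL : finrank ℚ L = p) :
    (baseIdeals K N).relIndex (ambiguousPrincipalIdeals K N p ⊔ baseIdeals K N) =
      Nat.card (AbsolutePrincipalFactors p N L) *
        Nat.card (RelativePrincipalFactors p N K L) := by
  have hle : ambiguousPrincipalIdeals K N p ⊔ baseIdeals K N ≤ ambiguousIdeals K N p :=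
    sup_le inf_le_left (baseIdeals_le_ambiguousIdeals K N p)
  have hbase : baseIdeals K N ≤
      normKernel p N K L ⊓ (ambiguousPrincipalIdeals K N p ⊔ baseIdeals K N) :=
    le_inf (le_inf (baseIdeals_le_ambiguousIdeals K N p)
      fun _ hx => idealNorm_mem_baseIdeals hp hp2 hN hK hL hx) le_sup_right
  rw [← Subgroup.relIndex_mul_relIndex _ _ _ hbase inf_le_right, mul_comm]
  congr 1
  rw [normKernel, inf_right_comm, inf_eq_right.mpr hle, Subgroup.inf_relIndex_left,
    Subgroup.relIndex_comap, ← Subgroup.relIndex_sup_right,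
    map_idealNorm_sup p N K L hp hp2 hN hK hL,
    ← basePrincipalIdeals_rat]
  rfl

theorem pow_eq_one_subQuotient {G : Type*} [CommGroup G] {S T : Subgroup G} {n : ℕ}
    (h : ∀ x ∈ S, x ^ n ∈ T) (x : SubQuotient S T) : x ^ n = 1 := by
  induction x using QuotientGroup.induction_on with
  | H x =>
    rw [← QuotientGroup.mk_pow, QuotientGroup.eq_one_iff]
    exact h x x.2

end Dihedral

/-! ### Dimensions over 𝔽_p from orders -/

section Dimension

theorem HasFpDim.card {p : ℕ} [NeZero p] {G : Type*} [CommGroup G] {d : ℕ} (h : HasFpDim p G d) :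
    Nat.card G = p ^ d := by
  obtain ⟨e⟩ := h
  rw [← Nat.card_congr (Additive.ofMul (α := G)).symm, Nat.card_congr e.toEquiv]
  simp

theorem exists_addEquiv_fun_of_module (k V : Type*) [Field k] [AddCommGroup V] [Finite V]
    [Module k V] : ∃ d, Nonempty (V ≃+ (Fin d → k)) :=
  ⟨_, ⟨(Module.finBasis k V).equivFun.toAddEquiv⟩⟩

theorem exists_addEquiv_fun_zmod (p : ℕ) [Fact p.Prime] (V : Type*) [AddCommGroup V] [Finite V]
    (h : ∀ x : V, p • x = 0) : ∃ d, Nonempty (V ≃+ (Fin d → ZMod p)) :=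
  @exists_addEquiv_fun_of_module (ZMod p) V _ _ _ (AddCommGroup.zmodModule h)

theorem exists_hasFpDim {p : ℕ} (hp : p.Prime) {G : Type*} [CommGroup G]
    (h0 : Nat.card G ≠ 0) (h : ∀ x : G, x ^ p = 1) : ∃ d, HasFpDim p G d := by
  have : Fact p.Prime := ⟨hp⟩
  have : Finite G := Nat.finite_of_card_ne_zero h0
  have : Finite (Additive G) := inferInstanceAs (Finite G)
  exact exists_addEquiv_fun_zmod p (Additive G) h

theorem hasFpDim_of_card {p : ℕ} (hp : p.Prime) {G : Type*} [CommGroup G] {d : ℕ}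
    (hcard : Nat.card G = p ^ d) (h : ∀ x : G, x ^ p = 1) : HasFpDim p G d := by
  have : NeZero p := ⟨hp.ne_zero⟩
  obtain ⟨d', hd'⟩ := exists_hasFpDim hp (by rw [hcard]; exact pow_ne_zero _ hp.ne_zero) h
  have := hd'.card
  rw [hcard] at this
  rwa [Nat.pow_right_injective hp.two_le this]

end Dimension

/-! ### Subfields of degree 2 and p -/

section Galois

variable {p : ℕ} {N : Type*} [Field N] [NumberField N] [IsGalois ℚ N]

theorem card_fixingSubgroup (F : IntermediateField ℚ N) :
    Nat.card F.fixingSubgroup = finrank F N :=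
  IsGalois.card_fixingSubgroup_eq_finrank F

theorem exists_intermediateField_of_dvd {q m : ℕ} (hq : q.Prime) (hN : finrank ℚ N = q * m) :
    ∃ F : IntermediateField ℚ N, finrank ℚ F = m := by
  have : Fact q.Prime := ⟨hq⟩
  have hcard : Nat.card (N ≃ₐ[ℚ] N) = q * m := by rw [IsGalois.card_aut_eq_finrank, hN]
  obtain ⟨σ, hσ⟩ := exists_prime_orderOf_dvd_card' (G := N ≃ₐ[ℚ] N) q (by rw [hcard]; simp)
  refine ⟨IntermediateField.fixedField (Subgroup.zpowers σ), ?_⟩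
  have h1 := IntermediateField.finrank_fixedField_eq_card (Subgroup.zpowers σ)
  rw [Nat.card_zpowers, hσ] at h1
  have h2 := finrank_mul_finrank ℚ (IntermediateField.fixedField (Subgroup.zpowers σ)) N
  rw [h1, hN, mul_comm] at h2
  exact Nat.eq_of_mul_eq_mul_left hq.pos h2

theorem isComplement'_fixingSubgroup (hp : p.Prime) (hp2 : p ≠ 2) (hN : finrank ℚ N = 2 * p)
    {K L : IntermediateField ℚ N} (hK : finrank ℚ K = 2) (hL : finrank ℚ L = p) :
    Subgroup.IsComplement' K.fixingSubgroup L.fixingSubgroup := by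
  have h1 : Nat.card K.fixingSubgroup = p := by
    rw [card_fixingSubgroup, finrank_right_eq two_ne_zero hN hK]
  have h2 : Nat.card L.fixingSubgroup = 2 := by
    rw [card_fixingSubgroup, finrank_right_eq hp.ne_zero (by rw [hN, mul_comm]) hL]
  apply Subgroup.isComplement'_of_coprime
  · rw [h1, h2, IsGalois.card_aut_eq_finrank, hN, mul_comm]
  · rw [h1, h2, Nat.coprime_primes hp Nat.prime_two]; exact hp2

/-- Both fixing groups have order p, and one is normal of index 2; the relative index divides p and
2. -/
theorem quadratic_subfield_unique (hp : p.Prime) (hp2 : p ≠ 2) (hN : finrank ℚ N = 2 * p)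
    {K K' : IntermediateField ℚ N} (hK : finrank ℚ K = 2) (hK' : finrank ℚ K' = 2) : K = K' := by
  have hcard : ∀ {F : IntermediateField ℚ N}, finrank ℚ F = 2 → Nat.card F.fixingSubgroup = p := by
    intro F hF
    rw [card_fixingSubgroup, finrank_right_eq two_ne_zero hN hF]
  have : Fact p.Prime := ⟨hp⟩
  have hG : Nat.card (N ≃ₐ[ℚ] N) = 2 * p := by rw [IsGalois.card_aut_eq_finrank, hN]
  have hnorm : K.fixingSubgroup.Normal := by
    apply Subgroup.normal_of_index_eq_two
    have := K.fixingSubgroup.card_mul_index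
    rw [hcard hK, hG, mul_comm] at this
    exact Nat.eq_of_mul_eq_mul_right hp.pos this
  have key : K'.fixingSubgroup ≤ K.fixingSubgroup := by
    rw [← Subgroup.relIndex_eq_one]
    have h1 : K.fixingSubgroup.relIndex K'.fixingSubgroup ∣ p := by
      rw [← hcard hK']; exact Subgroup.relIndex_dvd_card _ _
    have h2 : K.fixingSubgroup.relIndex K'.fixingSubgroup ∣ 2 := by
      have h3 := Subgroup.relIndex_dvd_index_of_normal K.fixingSubgroup K'.fixingSubgroup
      have := K.fixingSubgroup.card_mul_index
      rw [hcard hK, hG, mul_comm] at this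
      rwa [Nat.eq_of_mul_eq_mul_right hp.pos this] at h3
    exact Nat.eq_one_of_dvd_coprimes ((Nat.coprime_primes hp Nat.prime_two).mpr hp2) h1 h2
  have heq : K'.fixingSubgroup = K.fixingSubgroup :=
    Subgroup.eq_of_le_of_card_ge key (by rw [hcard hK, hcard hK'])
  rw [← IsGalois.fixedField_fixingSubgroup K, ← IsGalois.fixedField_fixingSubgroup K', heq]

/-- The groups fixing L and L' are Sylow 2-subgroups, hence conjugate. The conjugating element
factors through the complements Gal(N/K) and Gal(N/L), and the second factor acts trivially on L. -/
theorem exists_conj_of_finrank_eq (hp : p.Prime) (hp2 : p ≠ 2) (hN : finrank ℚ N = 2 * p)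
    {K L L' : IntermediateField ℚ N} (hK : finrank ℚ K = 2) (hL : finrank ℚ L = p)
    (hL' : finrank ℚ L' = p) : ∃ g ∈ K.fixingSubgroup, ∀ x ∈ L, g x ∈ L' := by
  have hodd := hp.odd_of_ne_two hp2
  have : Fact (Nat.Prime 2) := ⟨Nat.prime_two⟩
  have hG : Nat.card (N ≃ₐ[ℚ] N) = 2 * p := by rw [IsGalois.card_aut_eq_finrank, hN]
  have hcard : ∀ {F : IntermediateField ℚ N}, finrank ℚ F = p →
      Nat.card F.fixingSubgroup = 2 ^ (Nat.card (N ≃ₐ[ℚ] N)).factorization 2 := by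
    intro F hF
    rw [card_fixingSubgroup, finrank_right_eq hp.ne_zero (by rw [hN, mul_comm]) hF, hG,
      Nat.factorization_mul two_ne_zero hp.ne_zero, Nat.prime_two.factorization,
      hp.factorization]
    simp [hp2]
  obtain ⟨g, hg⟩ := MulAction.exists_smul_eq (N ≃ₐ[ℚ] N)
    (Sylow.ofCard L.fixingSubgroup (hcard hL)) (Sylow.ofCard L'.fixingSubgroup (hcard hL'))
  have hg' : ∀ τ ∈ L'.fixingSubgroup, g⁻¹ * τ * g ∈ L.fixingSubgroup := by
    intro τ hτ
    have h1 : τ ∈ (Sylow.ofCard L'.fixingSubgroup (hcard hL') : Subgroup (N ≃ₐ[ℚ] N)) := hτ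
    rw [← hg, Sylow.coe_subgroup_smul, Subgroup.mem_pointwise_smul_iff_inv_smul_mem] at h1
    have h2 : (MulAut.conj g)⁻¹ • τ ∈ L.fixingSubgroup := h1
    rwa [← map_inv, MulAut.smul_def, MulAut.conj_apply, inv_inv] at h2
  have hmap : ∀ x ∈ L, g x ∈ L' := by
    intro x hx
    rw [← IsGalois.fixedField_fixingSubgroup L', IntermediateField.mem_fixedField_iff]
    intro τ hτ
    have h := (IntermediateField.mem_fixingSubgroup_iff _ _).mp (hg' τ hτ) x hx
    have h2 := congrArg g h
    rw [← AlgEquiv.mul_apply] at h2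
    rwa [← mul_assoc, ← mul_assoc, mul_inv_cancel, one_mul] at h2
  obtain ⟨⟨a, b⟩, hab⟩ := (isComplement'_fixingSubgroup hp hp2 hN hK hL).2 g
  refine ⟨a, a.2, fun x hx => ?_⟩
  have hb := (IntermediateField.mem_fixingSubgroup_iff _ _).mp b.2 x hx
  have := hmap x hx
  rw [← hab] at this
  change (a : N ≃ₐ[ℚ] N) ((b : N ≃ₐ[ℚ] N) x) ∈ L' at this
  rwa [hb] at this

end Galois

/-! ### Independence of L, the product formula and the nine types -/

section Classification

variable {p : ℕ} {N : Type*} [Field N] [NumberField N] {K L L' : IntermediateField ℚ N}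

/-- An element g of Gal(N/K) carries L into L'. The ideal of x in N has its p-th power from K, so g
fixes it, and g x in L' generates the same ideal of N as x. -/
theorem map_extend_ambiguousPrincipalIdeals_le [IsGalois ℚ N] (hp : p.Prime) (hp2 : p ≠ 2)
    (hN : finrank ℚ N = 2 * p) (hK : finrank ℚ K = 2) (hL : finrank ℚ L = p)
    (hL' : finrank ℚ L' = p) :
    (ambiguousPrincipalIdeals ℚ L p).map (extend L N) ≤
      (ambiguousPrincipalIdeals ℚ L' p).map (extend L' N) := by
  obtain ⟨g, hg, hgL⟩ := exists_conj_of_finrank_eq hp hp2 hN hK hL hL'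
  rintro _ ⟨_, ⟨⟨c, hc⟩, ⟨x, rfl⟩⟩, rfl⟩
  have hc' : toPrincipalIdeal (𝓞 L) L x ^ p = extend ℚ L c := hc.symm
  let xN : Nˣ := Units.map (algebraMap L N).toMonoidHom x
  have hxN : extend L N (toPrincipalIdeal (𝓞 L) L x) = toPrincipalIdeal (𝓞 N) N xN :=
    extend_toPrincipalIdeal L N x
  have hpow : toPrincipalIdeal (𝓞 N) N xN ^ p = extend ℚ N c := by
    rw [← hxN, ← map_pow, hc', extend_extend]
  let σ : N ≃ₐ[K] N := K.fixingSubgroupEquiv ⟨g, hg⟩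
  have hunit := apply_div_self_mem_range_unitsToField (F := K) hp.ne_zero
    (x := xN) ⟨extend ℚ K c, by rw [hpow, extend_extend]⟩ σ
  rw [← ker_toPrincipalIdeal, MonoidHom.mem_ker, map_div, div_eq_one] at hunit
  have hy0 : (⟨g (x : L), hgL _ (x : L).2⟩ : L') ≠ 0 := by
    intro h
    have h1 : g ((x : L) : N) = 0 := congrArg (fun z : L' => (z : N)) h
    rw [map_eq_zero_iff g g.injective, ZeroMemClass.coe_eq_zero] at h1
    exact x.ne_zero h1
  let y : L'ˣ := Units.mk0 _ hy0
  have hy : extend L' N (toPrincipalIdeal (𝓞 L') L' y) = toPrincipalIdeal (𝓞 N) N xN := by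
    have hyσ : Units.map (algebraMap L' N).toMonoidHom y = Units.map (σ : N →* N) xN :=
      Units.ext rfl
    rw [extend_toPrincipalIdeal, ← hunit, hyσ]
  refine ⟨toPrincipalIdeal (𝓞 L') L' y, ⟨⟨c, ?_⟩, ⟨y, rfl⟩⟩, by rw [hy, hxN]⟩
  apply extend_injective L' N
  change _ = extend L' N (_ ^ p)
  rw [extend_extend, map_pow, hy, hpow]

theorem card_absolutePrincipalFactors :
    Nat.card (AbsolutePrincipalFactors p N L) =
      (basePrincipalIdeals ℚ N).relIndex ((ambiguousPrincipalIdeals ℚ L p).map (extend L N)) := by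
  have h : basePrincipalIdeals ℚ N = (basePrincipalIdeals ℚ L).map (extend L N) := by
    have hcomp : (extend L N).comp (extend ℚ L) = extend ℚ N :=
      MonoidHom.ext fun I => by rw [MonoidHom.comp_apply, extend_extend]
    rw [basePrincipalIdeals, basePrincipalIdeals, Subgroup.map_map, hcomp]
  rw [h, Subgroup.relIndex_map_map_of_injective _ _ (extend_injective L N), Subgroup.relIndex,
    Subgroup.index]

theorem card_absolutePrincipalFactors_eq [IsGalois ℚ N] (hp : p.Prime) (hp2 : p ≠ 2)
    (hN : finrank ℚ N = 2 * p) (hK : finrank ℚ K = 2) (hL : finrank ℚ L = p)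
    (hL' : finrank ℚ L' = p) :
    Nat.card (AbsolutePrincipalFactors p N L) = Nat.card (AbsolutePrincipalFactors p N L') := by
  rw [card_absolutePrincipalFactors, card_absolutePrincipalFactors,
    le_antisymm (map_extend_ambiguousPrincipalIdeals_le hp hp2 hN hK hL hL')
      (map_extend_ambiguousPrincipalIdeals_le hp hp2 hN hK hL' hL)]

theorem card_mul_card_mul_card [IsGalois ℚ N] [IsTotallyReal N] (hp : p.Prime) (hp2 : p ≠ 2)
    (hN : finrank ℚ N = 2 * p) (hK : finrank ℚ K = 2) (hL : finrank ℚ L = p) :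
    (normUnits N K).index ∣ p ∧
      Nat.card (CapitulationKernel N K) * (Nat.card (AbsolutePrincipalFactors p N L) *
        Nat.card (RelativePrincipalFactors p N K L)) = p * (normUnits N K).index := by
  have hrank : Units.rank K = 1 := by
    have := units_rank_add_one K
    omega
  obtain ⟨h1, h2⟩ := relIndex_ambiguousPrincipalIdeals (F := K) (E := N) hp hp2
    (finrank_right_eq two_ne_zero hN hK)
  rw [hrank, pow_one] at h1
  rw [relIndex_ambiguousPrincipalIdeals_eq_mul,
    relIndex_ambiguousPrincipalIdeals_sup p N K L hp hp2 hN hK hL] at h2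
  exact ⟨h1, h2⟩

theorem pow_eq_one_absolutePrincipalFactors (c : AbsolutePrincipalFactors p N L) : c ^ p = 1 :=
  pow_eq_one_subQuotient (S := ambiguousPrincipalIdeals ℚ L p) (T := basePrincipalIdeals ℚ L)
    (fun x hx => by rw [basePrincipalIdeals_rat]; exact hx.1) c

theorem pow_eq_one_relativePrincipalFactors (c : RelativePrincipalFactors p N K L) : c ^ p = 1 :=
  pow_eq_one_subQuotient
    (S := normKernel p N K L ⊓ (ambiguousPrincipalIdeals K N p ⊔ baseIdeals K N))
    (T := baseIdeals K N) (fun _ hx => hx.1.1) c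

theorem exists_hasInvariants [IsGalois ℚ N] [IsTotallyReal N] (hp : p.Prime) (hp2 : p ≠ 2)
    (hN : finrank ℚ N = 2 * p) :
    ∃ v : Invariants, HasInvariants p N v ∧ (v.U = 0 ∨ v.U = 1) ∧ v.A + v.R + v.C = v.U + 1 := by
  have : NeZero p := ⟨hp.ne_zero⟩
  obtain ⟨K, hK⟩ := exists_intermediateField_of_dvd hp (hN.trans (mul_comm _ _))
  obtain ⟨L, hL⟩ := exists_intermediateField_of_dvd Nat.prime_two hN
  obtain ⟨hU, hprod⟩ := card_mul_card_mul_card hp hp2 hN hK hL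
  obtain ⟨U, hU1, hUp⟩ : ∃ U ≤ 1, (normUnits N K).index = p ^ U := by
    rcases (Nat.dvd_prime hp).mp hU with h | h
    · exact ⟨0, zero_le_one, by rw [h, pow_zero]⟩
    · exact ⟨1, le_rfl, by rw [h, pow_one]⟩
  have hne : p * (normUnits N K).index ≠ 0 := by
    rw [hUp]; exact mul_ne_zero hp.ne_zero (pow_ne_zero _ hp.ne_zero)
  rw [← hprod] at hne
  have hA0 := left_ne_zero_of_mul (right_ne_zero_of_mul hne)
  have hR0 := right_ne_zero_of_mul (right_ne_zero_of_mul hne)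
  have hC0 := left_ne_zero_of_mul hne
  have hCpow : ∀ c : CapitulationKernel N K, c ^ p = 1 :=
    pow_eq_one_of_mem_ker_extendedHom hp (finrank_right_eq two_ne_zero hN hK)
  obtain ⟨A, hA⟩ := exists_hasFpDim hp hA0 pow_eq_one_absolutePrincipalFactors
  obtain ⟨R, hR⟩ := exists_hasFpDim hp hR0 pow_eq_one_relativePrincipalFactors
  obtain ⟨C, hC⟩ := exists_hasFpDim hp hC0 hCpow
  refine ⟨⟨U, A, R, C⟩, ?_, by simp only; omega, ?_⟩
  · intro K' L' hK' hL'
    obtain rfl := quadratic_subfield_unique hp hp2 hN hK hK'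
    have hA' := card_absolutePrincipalFactors_eq hp hp2 hN hK hL hL'
    refine ⟨hUp, hasFpDim_of_card hp (by rw [← hA', hA.card]) pow_eq_one_absolutePrincipalFactors,
      hasFpDim_of_card hp ?_ pow_eq_one_relativePrincipalFactors, hC⟩
    -- The order of the relative factors is determined by the product formula, whose other terms do
    -- not depend on L.
    have hprod' := (card_mul_card_mul_card hp hp2 hN hK hL').2
    rw [← hprod, ← hA'] at hprod'
    rw [← hR.card]
    exact Nat.eq_of_mul_eq_mul_left (Nat.pos_of_ne_zero hA0)
      (Nat.eq_of_mul_eq_mul_left (Nat.pos_of_ne_zero hC0) hprod')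
  · rw [hA.card, hR.card, hC.card, hUp, ← pow_add, ← pow_add, ← pow_succ'] at hprod
    have := Nat.pow_right_injective hp.two_le hprod
    simp only
    omega

theorem HasFpDim.unique (hp : p.Prime) {G : Type*} [CommGroup G] {d d' : ℕ}
    (h : HasFpDim p G d) (h' : HasFpDim p G d') : d = d' := by
  have : NeZero p := ⟨hp.ne_zero⟩
  exact Nat.pow_right_injective hp.two_le (h.card.symm.trans h'.card)

theorem HasInvariants.unique [IsGalois ℚ N] (hp : p.Prime) (hN : finrank ℚ N = 2 * p)
    {v w : Invariants} (hv : HasInvariants p N v) (hw : HasInvariants p N w) : v = w := by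
  obtain ⟨K, hK⟩ := exists_intermediateField_of_dvd hp (hN.trans (mul_comm _ _))
  obtain ⟨L, hL⟩ := exists_intermediateField_of_dvd Nat.prime_two hN
  obtain ⟨hU, hA, hR, hC⟩ := hv K L hK hL
  obtain ⟨hU', hA', hR', hC'⟩ := hw K L hK hL
  exact Invariants.ext (Nat.pow_right_injective hp.two_le (hU.symm.trans hU'))
    (hA.unique hp hA') (hR.unique hp hR') (hC.unique hp hC')

theorem HasFineType.hasCoarseType {τ : FineType} (h : HasFineType p N τ) :
    HasCoarseType p N τ.coarse := by
  have hτ : τ.coarse.invariants = (τ.invariants.U, τ.invariants.A) := by cases τ <;> rfl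
  intro K L hK hL
  rw [hτ]
  exact ⟨(h K L hK hL).1, (h K L hK hL).2.1⟩

theorem HasCoarseType.unique [IsGalois ℚ N] (hp : p.Prime) (hN : finrank ℚ N = 2 * p)
    {μ μ' : CoarseType} (h : HasCoarseType p N μ) (h' : HasCoarseType p N μ') : μ = μ' := by
  obtain ⟨K, hK⟩ := exists_intermediateField_of_dvd hp (hN.trans (mul_comm _ _))
  obtain ⟨L, hL⟩ := exists_intermediateField_of_dvd Nat.prime_two hN
  obtain ⟨hU, hA⟩ := h K L hK hL
  obtain ⟨hU', hA'⟩ := h' K L hK hL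
  have e : μ.invariants = μ'.invariants :=
    Prod.ext (Nat.pow_right_injective hp.two_le (hU.symm.trans hU')) (hA.unique hp hA')
  revert e
  cases μ <;> cases μ' <;> simp [CoarseType.invariants]

theorem FineType.invariants_injective : Function.Injective FineType.invariants := by
  intro τ τ'
  cases τ <;> cases τ' <;> simp [FineType.invariants]

theorem exists_fineType_invariants_eq {v : Invariants} (hU : v.U = 0 ∨ v.U = 1)
    (hsum : v.A + v.R + v.C = v.U + 1) : ∃ τ : FineType, τ.invariants = v := by
  obtain ⟨U, A, R, C⟩ := v
  simp only at hU hsum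
  have hA : A ≤ 2 := by omega
  have hR : R ≤ 2 := by omega
  rcases hU with rfl | rfl
  · interval_cases A <;> interval_cases R <;> try omega
    · obtain rfl : C = 1 := by omega
      exact ⟨.delta1, rfl⟩
    · obtain rfl : C = 0 := by omega
      exact ⟨.delta2, rfl⟩
    · obtain rfl : C = 0 := by omega
      exact ⟨.epsilon, rfl⟩
  · interval_cases A <;> interval_cases R <;> try omega
    · obtain rfl : C = 2 := by omega
      exact ⟨.alpha1, rfl⟩
    · obtain rfl : C = 1 := by omega
      exact ⟨.alpha2, rfl⟩
    · obtain rfl : C = 0 := by omega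
      exact ⟨.alpha3, rfl⟩
    · obtain rfl : C = 1 := by omega
      exact ⟨.beta1, rfl⟩
    · obtain rfl : C = 0 := by omega
      exact ⟨.beta2, rfl⟩
    · obtain rfl : C = 0 := by omega
      exact ⟨.gamma, rfl⟩

end Classification

end DPF

theorem mainTheorem3 (p : ℕ) (hp : p.Prime) (hp2 : p ≠ 2)
    (N : Type*) [Field N] [NumberField N] [IsGalois ℚ N] [IsTotallyReal N]
    (hN : Nonempty ((N ≃ₐ[ℚ] N) ≃* DihedralGroup p)) :
    -- the invariants `U`, `A`, `R`, `C` exist, are unique, and satisfy `A + R + C = U + 1`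
    (∃ v : DPF.Invariants, DPF.HasInvariants p N v ∧
      (∀ w : DPF.Invariants, DPF.HasInvariants p N w → w = v) ∧
      (v.U = 0 ∨ v.U = 1) ∧ v.A + v.R + v.C = v.U + 1) ∧
    -- `N` belongs to precisely one of the nine types
    (∃! τ : DPF.FineType, DPF.HasFineType p N τ) ∧
    -- the nine types refine the five coarse types
    (∀ τ : DPF.FineType, DPF.HasFineType p N τ →
      ∀ μ : DPF.CoarseType, DPF.HasCoarseType p N μ ↔ μ = τ.coarse) := by
  obtain ⟨e⟩ := hN
  have hdeg : finrank ℚ N = 2 * p := by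
    rw [← IsGalois.card_aut_eq_finrank, Nat.card_congr e.toEquiv, DihedralGroup.nat_card]
  obtain ⟨v, hv, hU, hsum⟩ := DPF.exists_hasInvariants hp hp2 hdeg
  obtain ⟨τ, rfl⟩ := DPF.exists_fineType_invariants_eq hU hsum
  refine ⟨⟨_, hv, fun w hw => hw.unique hp hdeg hv, hU, hsum⟩, ⟨τ, hv, fun τ' hτ' =>
    DPF.FineType.invariants_injective (DPF.HasInvariants.unique hp hdeg hτ' hv)⟩,
    fun τ' hτ' μ => ⟨fun hμ => hμ.unique hp hdeg hτ'.hasCoarseType, ?_⟩⟩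
  rintro rfl
  exact hτ'.hasCoarseType
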